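/- **Setting.** Consider $n$ qubits, $d=2^n$, let $\overline{\mathcal P}_n=\{I,X,Y,Z\}^{\otimes n}$, and let $\mathrm{Cl}_n$ be the $n$-qubit Clifford group, with the uniform distribution (modulo global phases). In one round of Clifford-based shadow estimation with common randomized measurements (CRM) and prior state $\sigma$, one samples $U\in\mathrm{Cl}_n$ uniformly and measures $U\rho U^\dagger$ in the computational basis $R\ge 1$ times, independently, with outcomes $s_1,\dots,s_R$. With $P_\sigma(s|U)=\langle s|U\sigma U^\dagger|s\rangle$ and $\mathcal M(A)=\mathbb E_U\sum_s\langle s|UAU^\dagger|s\rangle\,U^\dagger|s\rangle\langle s|U$, the round yields the estimator $\hat O=\operatorname{Tr}[O(\hat\rho-\hat\sigma+\sigma)]$ of $\operatorname{Tr}(O\rho)$, where $$\hat\rho=\frac1R\sum_{k=1}^R\mathcal M^{-1}(U^\dagger|s_k\rangle\langle s_k|U),\qquad \hat\sigma=\sum_sP_\sigma(s|U)\,\mathcal M^{-1}(U^\dagger|s\rangle\langle s|U).$$ Let $\mathbb V_R(\hat O)$ be its variance. From $N$ independent rounds (hence $N$ random circuits) and a number $K\le N$ of groups, form the median of the means of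 $\hat O$ over $K$ disjoint groups of $\lfloor N/K\rfloor$ rounds each (the empirical mean if $K=1$). Let $\sigma=|\phi\rangle\langle\phi|$ be a pure state, $\epsilon=1-\langle\phi|\rho|\phi\rangle>0$ the infidelity of the system state $\rho$, $O=\sigma-\mathbb 1/d$, $r>0$ and $0<\delta<1$. Let $N_U(K)$ be the smallest number such that for every $N\ge N_U(K)$ the median of means of $N$ rounds with $K$ groups estimates $\operatorname{Tr}(O\rho)$ (equivalently the fidelity, up to the constant $1/d$) within error $r\epsilon$ with probability at least $1-\delta$. Put $K_\delta=\lceil 2\ln(2/\delta)\rceil$, let $N_U^{\mathbb V}=\left\lceil\frac{68\,\mathbb V_R(\hat O)}{r^2\epsilon^2}\ln\frac2\delta\right\rceil$ be the number of circuits prescribed by the variance, and let $M_2(\sigma)=\log_2\bigl(d/\sum_{P\in\overline{\mathcal P}_n}|\operatorname{Tr}(\sigma P)|^4\bigr)$ be the stabilizer 2-Rényi entropy. **Theorem.** The measurement channel $\mathcal M$ is invertible, and the following hold. 1. Let $\rho=\sum_{P\in\overline{\mathcal P}_n}p(P)\,P\sigma P$, where $p$ is a probability distribution on $\overline{\mathcal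 P}_n$ (a Pauli channel applied to $\sigma$), and let $$B=\left\lceil136\ln\left(\frac2\delta\right)\left(\frac2{r^2}+\frac1{Rr^2\epsilon^2}\right)\right\rceil .$$ Then $N_U^{\mathbb V}\le B$ and $N_U(K_\delta)\le\max\{B,K_\delta\}$. If $r\le1$, then $N_U(K_\delta)\le B$. If $68\,\delta\ln(2/\delta)\ge1$ (for instance, if $\delta\geq 1/400$), then $N_U(1)\le B$. 2. Let $\rho=(1-q)\sigma+q\mathbb 1/d$ with $0\le q\le1$ (a depolarizing channel applied to $\sigma$), and let $$B=\left\lceil136\ln\left(\frac2\delta\right)\left[\frac{2^{-M_2(\sigma)}}{r^2}+\frac1{Rr^2\epsilon^2}\right]\right\rceil .$$ Then $N_U^{\mathbb V}\le B$ and $N_U(K_\delta)\le\max\{B,K_\delta\}$. If $68\,\delta\ln(2/\delta)\ge1$, then $N_U(1)\le B$. -/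

import Mathlib

open MeasureTheory

noncomputable section

namespace CRM

/-! ### Qubits, Pauli operators, Clifford group -/

/-- Labels of the computational basis of `n` qubits. -/
abbrev Bits (n : ℕ) : Type := Fin n → Fin 2

/-- Operators on the `2 ^ n`-dimensional Hilbert space of `n` qubits. -/
abbrev Op (n : ℕ) : Type := Matrix (Bits n) (Bits n) ℂ

/-- The four single-qubit Pauli matrices `I, X, Y, Z`. -/
def pauli1 : Fin 4 → Matrix (Fin 2) (Fin 2) ℂ :=
  ![!![1, 0; 0, 1], !![0, 1; 1, 0], !![0, -Complex.I; Complex.I, 0], !![1, 0; 0, -1]]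

/-- Labels of the `4 ^ n` Pauli operators in `{I, X, Y, Z}^{⊗ n}`. -/
abbrev PauliLabel (n : ℕ) : Type := Fin n → Fin 4

/-- The `n`-qubit Pauli operator `P_{a 0} ⊗ ⋯ ⊗ P_{a (n-1)}`. -/
def pauliOp {n : ℕ} (a : PauliLabel n) : Op n :=
  Matrix.of fun s t => ∏ i, pauli1 (a i) (s i) (t i)

/-- The set of signed Pauli operators `±P`. -/
def signedPaulis (n : ℕ) : Set (Op n) :=
  {A | ∃ a : PauliLabel n, A = pauliOp a ∨ A = -pauliOp a}

theorem signedPaulis_finite (n : ℕ) : (signedPaulis n).Finite := by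
  have h : signedPaulis n =
      Set.range (pauliOp (n := n)) ∪ Set.range (fun a : PauliLabel n => -pauliOp a) := by
    ext A
    simp only [signedPaulis, Set.mem_ofPred_eq, Set.mem_union, Set.mem_range]
    constructor
    · rintro ⟨a, h | h⟩
      · exact Or.inl ⟨a, h.symm⟩
      · exact Or.inr ⟨a, h.symm⟩
    · rintro (⟨a, h⟩ | ⟨a, h⟩)
      · exact ⟨a, Or.inl h.symm⟩
      · exact ⟨a, Or.inr h.symm⟩
  rw [h]
  exact (Set.finite_range _).union (Set.finite_range _)

theorem signedPaulis_neg {n : ℕ} {A : Op n} (h : A ∈ signedPaulis n) :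
    -A ∈ signedPaulis n := by
  obtain ⟨a, rfl | rfl⟩ := h
  · exact ⟨a, Or.inr rfl⟩
  · exact ⟨a, Or.inl (neg_neg _)⟩

/-- Conjugation by a unitary that maps every Pauli operator to a signed Pauli operator maps
signed Pauli operators to signed Pauli operators. -/
theorem conj_signed {n : ℕ} {U : Op n}
    (hU : ∀ a : PauliLabel n, U * pauliOp a * star U ∈ signedPaulis n)
    {A : Op n} (hA : A ∈ signedPaulis n) : U * A * star U ∈ signedPaulis n := by
  obtain ⟨a, rfl | rfl⟩ := hA
  · exact hU a
  · have := signedPaulis_neg (hU a)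
    simpa using this

/-- The `n`-qubit Clifford group: the unitaries `U` such that `U P U†` is a Pauli operator up
to sign for every Pauli operator `P`. -/
def cliffordGroup (n : ℕ) : Subgroup (Matrix.unitaryGroup (Bits n) ℂ) where
  carrier := {U | ∀ a : PauliLabel n, (U : Op n) * pauliOp a * star (U : Op n) ∈ signedPaulis n}
  one_mem' := by
    intro a
    exact ⟨a, Or.inl (by simp)⟩
  mul_mem' := by
    intro U V hU hV a
    have h := conj_signed hU (hV a)
    simpa [mul_assoc] using h
  inv_mem' := by
    intro U hU a
    have hUU : star (U : Op n) * (U : Op n) = 1 := Matrix.UnitaryGroup.star_mul_self U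
    have hmaps : Set.MapsTo (fun A : Op n => (U : Op n) * A * star (U : Op n))
        (signedPaulis n) (signedPaulis n) := fun A hA => conj_signed hU hA
    have hback : ∀ A : Op n, star (U : Op n) * ((U : Op n) * A * star (U : Op n)) * (U : Op n)
        = A := by
      intro A
      calc _ = (star (U : Op n) * (U : Op n)) * A * (star (U : Op n) * (U : Op n)) := by
            simp only [mul_assoc]
        _ = A := by simp [hUU]
    have hinj : Set.InjOn (fun A : Op n => (U : Op n) * A * star (U : Op n))
        (signedPaulis n) := by
      intro A _ B _ hAB
      have h1 := hback A
      have h2 := hback B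
      simp only at hAB
      rw [hAB, h2] at h1
      exact h1.symm
    have : Finite (signedPaulis n) := signedPaulis_finite n
    have hsurj := Finite.surjective_of_injective (hmaps.restrict_inj.2 hinj)
    obtain ⟨⟨A, hA⟩, hA'⟩ := hsurj ⟨pauliOp a, a, Or.inl rfl⟩
    have hAa : (U : Op n) * A * star (U : Op n) = pauliOp a := congrArg Subtype.val hA'
    have : star (U : Op n) * pauliOp a * (U : Op n) = A := by rw [← hAa]; exact hback A
    simpa [this] using hA

/-- The global phases in the Clifford group. -/
def phases (n : ℕ) : Subgroup (cliffordGroup n) where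
  carrier := {U | ∃ c : ℂ, ((U : Matrix.unitaryGroup (Bits n) ℂ) : Op n) = c • (1 : Op n)}
  one_mem' := ⟨1, by simp⟩
  mul_mem' := by
    rintro U V ⟨c, hc⟩ ⟨c', hc'⟩
    exact ⟨c * c', by simp [hc, hc', smul_smul, mul_comm]⟩
  inv_mem' := by
    rintro U ⟨c, hc⟩
    exact ⟨star c, by simp [hc]⟩

/-- The Clifford group modulo global phases, a finite set. Its elements are the circuits that a
uniformly random Clifford unitary can realize. -/
def CliffordModPhase (n : ℕ) : Type := cliffordGroup n ⧸ phases n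

/-- A Clifford unitary in a given class. Everything below depends on it only through
`A ↦ U A U†` and `A ↦ U† A U`, hence not on the choice of the phase. -/
def CliffordModPhase.mat {n : ℕ} (c : CliffordModPhase n) : Op n :=
  ((Quotient.out c : cliffordGroup n) : Matrix.unitaryGroup (Bits n) ℂ)

/-- The coefficients of the matrix units of one qubit in the Pauli basis. -/
def unitCoeff (s t : Fin 2) (a : Fin 4) : ℂ := pauli1 a t s / 2

theorem unit_expand (s t x y : Fin 2) :
    ∑ a, unitCoeff s t a * pauli1 a x y = if s = x ∧ t = y then 1 else 0 := by
  fin_cases s <;> fin_cases t <;> fin_cases x <;> fin_cases y <;>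
    simp [unitCoeff, pauli1, Fin.sum_univ_four] <;>
    ring_nf <;> simp [Complex.I_sq] <;> norm_num

/-- Every matrix unit is a linear combination of Pauli operators. -/
theorem single_eq_sum {n : ℕ} (s t : Bits n) :
    (Matrix.single s t 1 : Op n) =
      ∑ a : PauliLabel n, (∏ i, unitCoeff (s i) (t i) (a i)) • pauliOp a := by
  ext x y
  simp only [Matrix.sum_apply, Matrix.smul_apply, pauliOp, Matrix.of_apply, smul_eq_mul,
    ← Finset.prod_mul_distrib]
  rw [← Fintype.prod_sum (fun i a => unitCoeff (s i) (t i) a * pauli1 a (x i) (y i))]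
  simp only [unit_expand, Matrix.single_apply]
  rw [Finset.prod_ite_zero]
  simp [funext_iff, forall_and]

/-- A matrix that commutes with every Pauli operator is a scalar. -/
theorem scalar_of_commute {n : ℕ} (A : Op n) (h : ∀ a : PauliLabel n, Commute (pauliOp a) A) :
    ∃ c : ℂ, A = c • (1 : Op n) := by
  have h1 : A ∈ Set.range (Matrix.scalar (Bits n)) := by
    apply Matrix.mem_range_scalar_of_commute_single
    intro s t _
    rw [single_eq_sum]
    exact Commute.sum_left _ _ _ fun a _ => (h a).smul_left _
  obtain ⟨c, rfl⟩ := h1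
  exact ⟨c, by rw [Matrix.smul_one_eq_diagonal]; rfl⟩

instance (n : ℕ) : Finite (CliffordModPhase n) := by
  have : Finite (signedPaulis n) := signedPaulis_finite n
  let f : CliffordModPhase n → (PauliLabel n → signedPaulis n) :=
    fun c a => ⟨c.mat * pauliOp a * star c.mat, (Quotient.out c : cliffordGroup n).2 a⟩
  refine Finite.of_injective f fun c c' hcc => ?_
  have hcl : QuotientGroup.mk (s := phases n) (Quotient.out c) =
      QuotientGroup.mk (s := phases n) (Quotient.out c') := by
    rw [QuotientGroup.eq]
    have e : (((Quotient.out c : cliffordGroup n)⁻¹ * (Quotient.out c' : cliffordGroup n) :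
        cliffordGroup n) : Matrix.unitaryGroup (Bits n) ℂ).1 = star c.mat * c'.mat := rfl
    refine scalar_of_commute (n := n) _ fun a => ?_
    rw [e]
    have h1 : c.mat * pauliOp a * star c.mat = c'.mat * pauliOp a * star c'.mat :=
      congrArg Subtype.val (congrFun hcc a)
    have u1 : star c.mat * c.mat = 1 := Matrix.UnitaryGroup.star_mul_self _
    have u2 : star c'.mat * c'.mat = 1 := Matrix.UnitaryGroup.star_mul_self _
    calc pauliOp a * (star c.mat * c'.mat)
        = (star c.mat * c.mat) * pauliOp a * star c.mat * c'.mat := by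
          rw [u1, one_mul, mul_assoc]
      _ = star c.mat * (c.mat * pauliOp a * star c.mat) * c'.mat := by simp only [mul_assoc]
      _ = star c.mat * c'.mat * pauliOp a * (star c'.mat * c'.mat) := by
          rw [h1]; simp only [mul_assoc]
      _ = star c.mat * c'.mat * pauliOp a := by rw [u2, mul_one]
  exact (Quotient.out_eq c).symm.trans (hcl.trans (Quotient.out_eq c'))

instance (n : ℕ) : Fintype (CliffordModPhase n) := Fintype.ofFinite _

instance (n : ℕ) : MeasurableSpace (CliffordModPhase n) := ⊤

/-! ### States and noise channels -/

/-- The pure state `|φ⟩⟨φ|`. -/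
def pureState {n : ℕ} (φ : EuclideanSpace ℂ (Bits n)) : Op n :=
  Matrix.of fun s t => φ s * star (φ t)

/-- The Pauli channel `A ↦ ∑ P, p(P) P A P`. -/
def pauliChannel {n : ℕ} (p : PauliLabel n → ℝ) (A : Op n) : Op n :=
  ∑ a, (p a : ℂ) • (pauliOp a * A * pauliOp a)

/-- The action `τ ↦ (1 - q) τ + q 𝟙 / d` of a depolarizing channel on states, `d = 2 ^ n`. -/
def depolarizing {n : ℕ} (q : ℝ) (τ : Op n) : Op n :=
  ((1 - q : ℝ) : ℂ) • τ + ((q / 2 ^ n : ℝ) : ℂ) • (1 : Op n)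

/-- The infidelity `1 - ⟨φ|ρ|φ⟩` between `ρ` and the pure state `|φ⟩⟨φ|`. -/
def infidelity {n : ℕ} (φ : EuclideanSpace ℂ (Bits n)) (ρ : Op n) : ℝ :=
  1 - (∑ s, ∑ t, star (φ s) * ρ s t * φ t).re

/-- The stabilizer 2-Rényi entropy `log₂ (d / ∑ P, |Tr (σ P)| ^ 4)`. -/
def sre2 {n : ℕ} (σ : Op n) : ℝ :=
  Real.logb 2 (2 ^ n / ∑ a : PauliLabel n, ‖(σ * pauliOp a).trace‖ ^ 4)

/-! ### Clifford shadow estimation with common randomized measurements -/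

/-- `U† |s⟩⟨s| U`. -/
def snapshot {n : ℕ} (U : Op n) (s : Bits n) : Op n :=
  star U * Matrix.single s s 1 * U

/-- `⟨s| U A U† |s⟩`; if `A` is a state, this is the probability of outcome `s`. -/
def bornValue {n : ℕ} (A U : Op n) (s : Bits n) : ℂ :=
  (U * A * star U) s s

/-- The measurement channel
`A ↦ 𝔼_U ∑ s, ⟨s| U A U† |s⟩ U† |s⟩⟨s| U` of the uniform distribution on the Clifford group. -/
def measurementChannel (n : ℕ) : Module.End ℂ (Op n) where
  toFun A := (Fintype.card (CliffordModPhase n) : ℂ)⁻¹ •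
    ∑ c : CliffordModPhase n, ∑ s : Bits n, bornValue A c.mat s • snapshot c.mat s
  map_add' A B := by
    simp only [bornValue, mul_add, add_mul, Matrix.add_apply, add_smul, Finset.sum_add_distrib,
      smul_add]
  map_smul' z A := by
    simp only [bornValue, Matrix.mul_smul, Matrix.smul_mul, Matrix.smul_apply, smul_eq_mul,
      mul_smul, ← Finset.smul_sum, RingHom.id_apply]
    rw [smul_comm]

/-- The reconstruction map, the inverse of the measurement channel. -/
def reconstruction (n : ℕ) : Module.End ℂ (Op n) := Ring.inverse (measurementChannel n)

/-- The data of one round: the random circuit and the outcomes of its `R` measurements. -/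
abbrev Round (n R : ℕ) : Type := CliffordModPhase n × (Fin R → Bits n)

/-- The law of one round on the system state `ρ`: the circuit is uniformly distributed and, given
the circuit, the `R` outcomes are independent and follow the Born rule. -/
def roundLaw {n : ℕ} (R : ℕ) (ρ : Op n) : Measure (Round n R) :=
  ∑ ω : Round n R, ENNReal.ofReal
    ((Fintype.card (CliffordModPhase n) : ℝ)⁻¹ * ∏ k, (bornValue ρ ω.1.mat (ω.2 k)).re) •
      Measure.dirac ω

/-- The estimator `ρ̂` of one round. -/
def rhoHat {n R : ℕ} (ω : Round n R) : Op n :=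
  (R : ℂ)⁻¹ • ∑ k, reconstruction n (snapshot ω.1.mat (ω.2 k))

/-- The simulated counterpart `σ̂` of `ρ̂` for the prior state `σ`. -/
def sigmaHat {n R : ℕ} (σ : Op n) (ω : Round n R) : Op n :=
  ∑ s, bornValue σ ω.1.mat s • reconstruction n (snapshot ω.1.mat s)

/-- The estimator `Tr (O (ρ̂ - σ̂ + σ))` of one round with prior state `σ`. -/
def crmEstimator {n R : ℕ} (σ O : Op n) (ω : Round n R) : ℝ :=
  (O * (rhoHat ω - sigmaHat σ ω + σ)).trace.re

/-- The variance `𝕍_R(Ô)` of the estimator of one round. -/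
def crmVariance {n : ℕ} (R : ℕ) (σ O ρ : Op n) : ℝ :=
  ProbabilityTheory.variance (crmEstimator (R := R) σ O) (roundLaw R ρ)

/-- The median of a list of reals (the average of the two middle elements if the length is
even). -/
def median (l : List ℝ) : ℝ :=
  let m := l.insertionSort (· ≤ ·)
  (m.getD ((l.length - 1) / 2) 0 + m.getD (l.length / 2) 0) / 2

/-- The median of means of `x 0, …, x (N - 1)` with `K` groups: the group `j < K` consists of the
`⌊N / K⌋` indices `i` with `j ⌊N / K⌋ ≤ i < (j + 1) ⌊N / K⌋`. For `K = 1` this is the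
empirical mean. -/
def medianOfMeans (K : ℕ) {N : ℕ} (x : Fin N → ℝ) : ℝ :=
  median (List.ofFn fun j : Fin K =>
    (∑ i : Fin N, if (i : ℕ) / (N / K) = (j : ℕ) then x i else 0) / ((N / K : ℕ) : ℝ))

/-- With `N` independent rounds and `K` groups, the median of means estimates `Tr (O ρ)` within
error `err` with probability at least `1 - δ`. -/
def Succeeds {n : ℕ} (R : ℕ) (σ O ρ : Op n) (err δ : ℝ) (K N : ℕ) : Prop :=
  K ≤ N ∧
    1 - δ ≤ (Measure.pi fun _ : Fin N => roundLaw R ρ).real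
      {ω | |medianOfMeans K (fun i => crmEstimator σ O (ω i)) - (O * ρ).trace.re| ≤ err}

/-- The circuit sample cost with `K` groups: the smallest number of circuits from which on the
median of means succeeds (`⊤` if there is none). -/
def circuitCost {n : ℕ} (R : ℕ) (σ O ρ : Op n) (err δ : ℝ) (K : ℕ) : ℕ∞ :=
  ⨅ (N : ℕ) (_ : ∀ M, N ≤ M → Succeeds R σ O ρ err δ K M), (N : ℕ∞)

/-- The observable `|φ⟩⟨φ| - 𝟙 / d` of fidelity estimation. -/
def fidelityObservable {n : ℕ} (φ : EuclideanSpace ℂ (Bits n)) : Op n :=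
  pureState φ - ((2 : ℂ) ^ n)⁻¹ • (1 : Op n)

/-- The circuit sample cost, with `K` groups, of estimating the fidelity between `ρ` and the target
and prior state `|φ⟩⟨φ|` within error `r ε` and significance level `δ`, where `ε` is the
infidelity. -/
def hpfeCost {n : ℕ} (R : ℕ) (φ : EuclideanSpace ℂ (Bits n)) (ρ : Op n) (r δ : ℝ) (K : ℕ) : ℕ∞ :=
  circuitCost R (pureState φ) (fidelityObservable φ) ρ (r * infidelity φ ρ) δ K

/-- The number `⌈68 𝕍_R(Ô) / (r ε)² · ln (2 / δ)⌉` of circuits that the variance prescribes in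
this task. -/
def hpfeVarianceCost {n : ℕ} (R : ℕ) (φ : EuclideanSpace ℂ (Bits n)) (ρ : Op n) (r δ : ℝ) : ℕ :=
  ⌈68 * crmVariance R (pureState φ) (fidelityObservable φ) ρ / (r * infidelity φ ρ) ^ 2 *
    Real.log (2 / δ)⌉₊

/-- The number `⌈2 ln (2 / δ)⌉` of groups in the median of means. -/
def numGroups (δ : ℝ) : ℕ := ⌈2 * Real.log (2 / δ)⌉₊

end CRM

end

namespace CRM

/-! ### Algebra of Pauli operators -/

/-! Write d = 2^n, L = ln(2/δ), and χ(a,b) = ±1 according to whether the Paulis P_a and P_b commute.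
The proof has two halves: a variance bound 𝕍 ≤ 2/R + 2Mε², with M = 2 for Pauli noise and M =
2^(-M₂(σ)) for depolarizing noise, and a concentration argument (`hpfeCost_bounds`) that turns any
such bound into sample costs.

A Clifford circuit maps a Pauli operator to a signed Pauli operator, which is either diagonal or has
zero diagonal. Hence all Clifford averages reduce to the probability `jointProb a b` that a random
circuit diagonalizes both P_a and P_b. This probability vanishes if they anticommute. For fixed a it
is constant over the b ∉ {0, a} that commute with a, because the Cliffords (P_b + P_b')/√2 act
transitively on them. Every circuit diagonalizes exactly d Paulis, and this sum rule fixes the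
constant. The result is `jointProb_formula`; it yields the inverse of the measurement channel and
the second and third moments used below.

By the law of total variance (`crmVariance_eq`), 𝕍 is 1/R times the outcome variance at fixed
circuit plus the variance over circuits of the conditional mean, which depends on ρ - σ only. The
third moment and Jensen's inequality bound the outcome variance by 2 - (1-F)² ≤ 2, where F is the
fidelity. The circuit part equals (d+1)/((d+2)d²) · [(dε)² + Σ y_a χ(a,b) y_b + d Σ y_a²] - ε²,
where y_a is minus the product of the Pauli coefficients of σ and ρ - σ, so that Σ y_a = dε
(`circuit_variance_eq`).

For Pauli noise 0 ≤ y_a ≤ 2ε, the upper bound being the uncertainty relation for anticommuting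
Paulis, and the bracket is at most 4d²ε². For depolarizing noise y_a is proportional to x_a² -
δ_{a,0}, with x_a the coefficients of σ. Self-duality of x_a² evaluates the bracket exactly in terms
of S = Σ x_a⁴ = d·2^(-M₂), and the claim becomes S(d² + 3d - 2) ≤ 2d³, which follows from S ≤ d.

For the concentration, Chebyshev bounds by p = 3/34 the probability that a group mean is off. If the
median is off, so are at least half of the K independent groups; a union bound over the 2^K sets of
groups gives failure probability at most (2√p)^K ≤ e^(-K/2) ≤ δ/2. For K = 1, Chebyshev alone
suffices. -/

theorem pauli1_mul_self (a : Fin 4) : pauli1 a * pauli1 a = 1 := by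
  fin_cases a <;> ext i j <;> fin_cases i <;> fin_cases j <;>
    simp [pauli1, Matrix.mul_apply, Fin.sum_univ_two]

theorem pauli1_star (a : Fin 4) (s t : Fin 2) : star (pauli1 a s t) = pauli1 a t s := by
  fin_cases a <;> fin_cases s <;> fin_cases t <;> simp [pauli1]

theorem pauli1_mul (a b : Fin 4) :
    ∃ (z : ℂ) (e : Fin 4), ‖z‖ = 1 ∧ pauli1 a * pauli1 b = z • pauli1 e := by
  fin_cases a <;> fin_cases b
  on_goal 1 => refine ⟨1, 0, by simp, ?_⟩
  on_goal 2 => refine ⟨1, 1, by simp, ?_⟩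
  on_goal 3 => refine ⟨1, 2, by simp, ?_⟩
  on_goal 4 => refine ⟨1, 3, by simp, ?_⟩
  on_goal 5 => refine ⟨1, 1, by simp, ?_⟩
  on_goal 6 => refine ⟨1, 0, by simp, ?_⟩
  on_goal 7 => refine ⟨Complex.I, 3, by simp, ?_⟩
  on_goal 8 => refine ⟨-Complex.I, 2, by simp, ?_⟩
  on_goal 9 => refine ⟨1, 2, by simp, ?_⟩
  on_goal 10 => refine ⟨-Complex.I, 3, by simp, ?_⟩
  on_goal 11 => refine ⟨1, 0, by simp, ?_⟩
  on_goal 12 => refine ⟨Complex.I, 1, by simp, ?_⟩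
  on_goal 13 => refine ⟨1, 3, by simp, ?_⟩
  on_goal 14 => refine ⟨Complex.I, 2, by simp, ?_⟩
  on_goal 15 => refine ⟨-Complex.I, 1, by simp, ?_⟩
  on_goal 16 => refine ⟨1, 0, by simp, ?_⟩
  all_goals
    ext i j; fin_cases i <;> fin_cases j <;>
      simp [pauli1, Matrix.mul_apply, Fin.sum_univ_two]

theorem pauli1_comm (a b : Fin 4) :
    ∃ c : ℝ, (c = 1 ∨ c = -1) ∧ pauli1 a * pauli1 b = (c : ℂ) • (pauli1 b * pauli1 a) := by
  by_cases h : a = b ∨ a = 0 ∨ b = 0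
  · refine ⟨1, Or.inl rfl, ?_⟩
    fin_cases a <;> fin_cases b <;> simp at h <;>
    (ext i j; fin_cases i <;> fin_cases j <;>
      simp [pauli1, Matrix.mul_apply, Fin.sum_univ_two])
  · refine ⟨-1, Or.inr rfl, ?_⟩
    fin_cases a <;> fin_cases b <;> simp at h <;>
    (ext i j; fin_cases i <;> fin_cases j <;>
      simp [pauli1, Matrix.mul_apply, Fin.sum_univ_two])

theorem pauli1_trace_mul (a b : Fin 4) :
    (pauli1 a * pauli1 b).trace = if a = b then 2 else 0 := by
  fin_cases a <;> fin_cases b <;>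
    simp [pauli1, Matrix.trace, Fin.sum_univ_two] <;> norm_num

theorem pauli1_diag (a : Fin 4) :
    (∀ s t, s ≠ t → pauli1 a s t = 0) ∨ ∀ s, pauli1 a s s = 0 := by
  fin_cases a
  on_goal 1 => left
  on_goal 2 => right
  on_goal 3 => right
  on_goal 4 => left
  all_goals simp [pauli1, Fin.forall_fin_two]

variable {n : ℕ}

theorem pauliOp_mul_apply (a b : PauliLabel n) (s t : Bits n) :
    (pauliOp a * pauliOp b) s t = ∏ i, (pauli1 (a i) * pauli1 (b i)) (s i) (t i) := by
  simp only [Matrix.mul_apply, pauliOp, Matrix.of_apply, ← Finset.prod_mul_distrib]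
  rw [← Fintype.prod_sum (fun i u => pauli1 (a i) (s i) u * pauli1 (b i) u (t i))]

theorem pauliOp_mul_self (a : PauliLabel n) : pauliOp a * pauliOp a = 1 := by
  ext s t
  rw [pauliOp_mul_apply]
  simp only [pauli1_mul_self, Matrix.one_apply]
  rw [Finset.prod_ite_zero]
  simp [funext_iff]

@[simp]
theorem pauliOp_star (a : PauliLabel n) : star (pauliOp a) = pauliOp a := by
  ext s t
  simp only [Matrix.star_apply, pauliOp, Matrix.of_apply, star_prod, pauli1_star]

theorem pauliOp_zero : pauliOp (0 : PauliLabel n) = 1 := by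
  have h : pauli1 0 = 1 := by
    ext i j; fin_cases i <;> fin_cases j <;> simp [pauli1]
  ext s t
  simp only [pauliOp, Matrix.of_apply, Pi.zero_apply, h, Matrix.one_apply]
  rw [Finset.prod_ite_zero]
  simp [funext_iff]

theorem pauliOp_mul (a b : PauliLabel n) :
    ∃ (z : ℂ) (e : PauliLabel n), ‖z‖ = 1 ∧ pauliOp a * pauliOp b = z • pauliOp e := by
  choose z e hz h using fun i => pauli1_mul (a i) (b i)
  refine ⟨∏ i, z i, e, by simp [norm_prod, hz], ?_⟩
  ext s t
  rw [pauliOp_mul_apply]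
  simp [h, pauliOp, Finset.prod_mul_distrib]

theorem pauliOp_comm (a b : PauliLabel n) :
    ∃ c : ℝ, (c = 1 ∨ c = -1) ∧ pauliOp a * pauliOp b = (c : ℂ) • (pauliOp b * pauliOp a) := by
  choose c hc h using fun i => pauli1_comm (a i) (b i)
  refine ⟨∏ i, c i, ?_, ?_⟩
  · refine Finset.prod_induction c (fun x => x = 1 ∨ x = -1) ?_ (Or.inl rfl) fun i _ => hc i
    rintro x y (rfl | rfl) (rfl | rfl) <;> simp
  · ext s t
    rw [Matrix.smul_apply, pauliOp_mul_apply, pauliOp_mul_apply]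
    simp [h, Finset.prod_mul_distrib]

theorem trace_pauliOp_mul (a b : PauliLabel n) :
    (pauliOp a * pauliOp b).trace = if a = b then (2 : ℂ) ^ n else 0 := by
  simp only [Matrix.trace, Matrix.diag_apply, pauliOp_mul_apply]
  rw [← Fintype.prod_sum (fun i u => (pauli1 (a i) * pauli1 (b i)) u u)]
  have := fun i => pauli1_trace_mul (a i) (b i)
  simp only [Matrix.trace, Matrix.diag_apply] at this
  simp only [this]
  rw [Finset.prod_ite_zero]
  simp [funext_iff]

theorem trace_pauliOp (a : PauliLabel n) :
    (pauliOp a).trace = if a = 0 then (2 : ℂ) ^ n else 0 := by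
  rw [← trace_pauliOp_mul, pauliOp_zero, mul_one]

theorem trace_one_op : (1 : Op n).trace = (2 : ℂ) ^ n := by
  rw [Matrix.trace_one]; simp

/-- A Pauli operator is either diagonal or has zero diagonal. -/
theorem pauliOp_isDiag_or (a : PauliLabel n) :
    (pauliOp a).IsDiag ∨ ∀ s, pauliOp a s s = 0 := by
  by_cases h : ∀ i, ∀ s t, s ≠ t → pauli1 (a i) s t = 0
  · left
    intro s t hst
    obtain ⟨i, hi⟩ := Function.ne_iff.1 hst
    exact Finset.prod_eq_zero (Finset.mem_univ i) (h i _ _ hi)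
  · right
    push Not at h
    obtain ⟨i, s, t, hst, h0⟩ := h
    have := (pauli1_diag (a i)).resolve_left fun h => h0 (h s t hst)
    intro u
    exact Finset.prod_eq_zero (Finset.mem_univ i) (this _)

theorem signedPaulis_isDiag_or {A : Op n} (hA : A ∈ signedPaulis n) :
    A.IsDiag ∨ ∀ s, A s s = 0 := by
  obtain ⟨a, rfl | rfl⟩ := hA
  · exact pauliOp_isDiag_or a
  · rcases pauliOp_isDiag_or a with h | h
    · exact Or.inl h.neg
    · exact Or.inr fun s => by simp [h s]

/-- Completeness of the Pauli basis in index form: Σ P ⊗ P is d times the swap operator. Contracting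
it with a matrix in two different ways gives the basis expansion `sum_trace_smul_pauliOp` and the
twirl `sum_pauliOp_conj`. -/
theorem sum_pauliOp_mul_pauliOp (s t x y : Bits n) :
    ∑ a : PauliLabel n, pauliOp a t s * pauliOp a x y =
      if s = x ∧ t = y then (2 : ℂ) ^ n else 0 := by
  have h := congrFun (congrFun (single_eq_sum s t) x) y
  simp only [Matrix.sum_apply, Matrix.smul_apply, smul_eq_mul, unitCoeff,
    Finset.prod_div_distrib, Finset.prod_const, Finset.card_univ, Fintype.card_fin,
    Matrix.single_apply] at h
  have h2 : (2 : ℂ) ^ n ≠ 0 := pow_ne_zero _ two_ne_zero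
  calc _ = 2 ^ n * ∑ a : PauliLabel n, (∏ i, pauli1 (a i) (t i) (s i)) / 2 ^ n * pauliOp a x y := by
        rw [Finset.mul_sum]
        refine Finset.sum_congr rfl fun a _ => ?_
        simp only [pauliOp, Matrix.of_apply]
        field_simp
    _ = _ := by rw [← h]; simp

/-- The Pauli operators form an orthogonal basis. -/
theorem sum_trace_smul_pauliOp (A : Op n) :
    ∑ a : PauliLabel n, (pauliOp a * A).trace • pauliOp a = (2 : ℂ) ^ n • A := by
  ext x y
  simp only [Matrix.sum_apply, Matrix.smul_apply, smul_eq_mul, Matrix.trace, Matrix.diag_apply,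
    Matrix.mul_apply, Finset.sum_mul]
  rw [Finset.sum_comm]
  simp_rw [Finset.sum_comm (s := (Finset.univ : Finset (PauliLabel n)))]
  have : ∀ t s : Bits n, ∑ a : PauliLabel n, pauliOp a t s * A s t * pauliOp a x y =
      A s t * (if s = x ∧ t = y then (2 : ℂ) ^ n else 0) := by
    intro t s
    rw [← sum_pauliOp_mul_pauliOp, Finset.mul_sum]
    exact Finset.sum_congr rfl fun a _ => by ring
  simp only [this]
  rw [Finset.sum_eq_single y, Finset.sum_eq_single x]
  · simp [mul_comm]
  · intro s _ h; simp [h]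
  · simp
  · intro t _ h; simp [h]
  · simp

/-- Parseval's identity in the Pauli basis. -/
theorem sum_trace_mul_trace (A B : Op n) :
    ∑ a : PauliLabel n, (pauliOp a * A).trace * (pauliOp a * B).trace =
      (2 : ℂ) ^ n * (A * B).trace := by
  have := congrArg (fun C => (C * B).trace) (sum_trace_smul_pauliOp A)
  simpa [Finset.sum_mul, Matrix.trace_sum] using this

theorem sum_pauliOp_conj (A : Op n) :
    ∑ a : PauliLabel n, pauliOp a * A * pauliOp a = ((2 : ℂ) ^ n * A.trace) • (1 : Op n) := by
  ext x y
  simp only [Matrix.sum_apply, Matrix.smul_apply, smul_eq_mul, Matrix.mul_apply, Finset.sum_mul]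
  simp_rw [Finset.sum_comm (s := (Finset.univ : Finset (PauliLabel n)))]
  have : ∀ s t : Bits n, ∑ a : PauliLabel n, pauliOp a x t * A t s * pauliOp a s y =
      A t s * (if t = s ∧ x = y then (2 : ℂ) ^ n else 0) := by
    intro s t
    rw [← sum_pauliOp_mul_pauliOp, Finset.mul_sum]
    exact Finset.sum_congr rfl fun a _ => by ring
  simp only [this]
  by_cases h : x = y
  · subst h
    simp [Matrix.trace, Finset.mul_sum, mul_comm]
  · simp [h]

/-! ### Commutation signs and their orthogonality -/

open Classical in
/-- The sign `1` or `-1` according to whether two Pauli operators commute or anticommute. -/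
noncomputable def comSign (a b : PauliLabel n) : ℝ :=
  if pauliOp a * pauliOp b = pauliOp b * pauliOp a then 1 else -1

theorem comSign_eq_or (a b : PauliLabel n) : comSign a b = 1 ∨ comSign a b = -1 := by
  unfold comSign; split_ifs <;> simp

theorem comSign_le_one (a b : PauliLabel n) : comSign a b ≤ 1 := by
  rcases comSign_eq_or a b with h | h
  · exact h.le
  · rw [h]; norm_num

theorem pauliOp_mul_comm (a b : PauliLabel n) :
    pauliOp a * pauliOp b = (comSign a b : ℂ) • (pauliOp b * pauliOp a) := by
  unfold comSign
  split_ifs with h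
  · simp [h]
  · obtain ⟨c, rfl | rfl, hc⟩ := pauliOp_comm a b
    · simp at hc; exact absurd hc h
    · exact hc

theorem pauliOp_conj (a b : PauliLabel n) :
    pauliOp a * pauliOp b * pauliOp a = (comSign a b : ℂ) • pauliOp b := by
  rw [pauliOp_mul_comm, Matrix.smul_mul, mul_assoc, pauliOp_mul_self, mul_one]

theorem comSign_symm (a b : PauliLabel n) : comSign a b = comSign b a := by
  unfold comSign; simp only [eq_comm]

@[simp]
theorem comSign_self (a : PauliLabel n) : comSign a a = 1 := by simp [comSign]

@[simp]
theorem comSign_zero_left (a : PauliLabel n) : comSign 0 a = 1 := by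
  simp [comSign, pauliOp_zero]

@[simp]
theorem comSign_zero_right (a : PauliLabel n) : comSign a 0 = 1 := by
  rw [comSign_symm, comSign_zero_left]

/-- If conjugation by each Pauli operator multiplies the unitary `A` by a sign, the signs add up to
`|Tr A| ^ 2`. -/
theorem sum_sign_eq {A : Op n} (hA : A * star A = 1) (χ : PauliLabel n → ℝ)
    (h : ∀ r, pauliOp r * A * pauliOp r = (χ r : ℂ) • A) :
    ∑ r, χ r = ‖A.trace‖ ^ 2 := by
  -- The Pauli twirl of A is both (Σ χ) A and d Tr(A) 𝟙; multiplying by A† and taking traces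
  -- compares the two.
  have h1 := sum_pauliOp_conj A
  simp only [h, ← Finset.sum_smul] at h1
  have h2 := congrArg (fun B => (B * star A).trace) h1
  simp only [Matrix.smul_mul, hA, Matrix.trace_smul, trace_one_op, one_mul, smul_eq_mul] at h2
  rw [Matrix.star_eq_conjTranspose, Matrix.trace_conjTranspose] at h2
  have h3 : (2 : ℂ) ^ n ≠ 0 := pow_ne_zero _ two_ne_zero
  have h4 : (∑ r, (χ r : ℂ)) = A.trace * star A.trace := by
    apply mul_right_cancel₀ h3; rw [h2]; ring
  rw [← Complex.ofReal_inj]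
  push_cast
  rw [h4]
  exact Complex.mul_conj' _

theorem sum_comSign (a : PauliLabel n) :
    ∑ r, comSign a r = if a = 0 then (4 : ℝ) ^ n else 0 := by
  rw [sum_sign_eq (A := pauliOp a) (by simp [pauliOp_mul_self]) _ fun r => ?_, trace_pauliOp]
  · split_ifs
    · rw [norm_pow]; rw [← pow_mul, mul_comm n 2, pow_mul]; norm_num
    · simp
  · rw [comSign_symm, pauliOp_conj]

theorem sum_comSign_mul (a b : PauliLabel n) :
    ∑ r, comSign a r * comSign b r = if a = b then (4 : ℝ) ^ n else 0 := by
  rw [sum_sign_eq (A := pauliOp a * pauliOp b) _ _ fun r => ?_, trace_pauliOp_mul]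
  · split_ifs
    · rw [norm_pow]; rw [← pow_mul, mul_comm n 2, pow_mul]; norm_num
    · simp
  · rw [star_mul, pauliOp_star, pauliOp_star, mul_assoc, ← mul_assoc (pauliOp b),
      pauliOp_mul_self, one_mul, pauliOp_mul_self]
  · calc pauliOp r * (pauliOp a * pauliOp b) * pauliOp r
        = (pauliOp r * pauliOp a * pauliOp r) * (pauliOp r * pauliOp b * pauliOp r) := by
          simp only [mul_assoc]
          rw [← mul_assoc (pauliOp r) (pauliOp r), pauliOp_mul_self, one_mul]
      _ = _ := by
          rw [pauliOp_conj, pauliOp_conj, comSign_symm r a, comSign_symm r b]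
          rw [Matrix.smul_mul, Matrix.mul_smul, smul_smul, Complex.ofReal_mul]

/-- The product of the three signs is the sign by which P_r acts on P_a P_b P_c, so the sum is the
squared modulus of a trace. Only its sign matters in `exists_comSign`. -/
theorem sum_comSign_mul_mul_nonneg (a b c : PauliLabel n) :
    0 ≤ ∑ r, comSign a r * comSign b r * comSign c r := by
  rw [sum_sign_eq (A := pauliOp a * pauliOp b * pauliOp c) _ _ fun r => ?_]
  · positivity
  · calc _ = pauliOp a * (pauliOp b * (pauliOp c * pauliOp c) * pauliOp b) * pauliOp a := by
          simp only [star_mul, pauliOp_star, mul_assoc]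
      _ = 1 := by simp [pauliOp_mul_self]
  · calc pauliOp r * (pauliOp a * pauliOp b * pauliOp c) * pauliOp r
        = (pauliOp r * pauliOp a * pauliOp r) * (pauliOp r * pauliOp b * pauliOp r) *
          (pauliOp r * pauliOp c * pauliOp r) := by
          have h : ∀ A : Op n, pauliOp r * (pauliOp r * A) = A := fun A => by
            rw [← mul_assoc, pauliOp_mul_self, one_mul]
          simp only [mul_assoc, h]
      _ = _ := by
          rw [pauliOp_conj, pauliOp_conj, pauliOp_conj, comSign_symm r a, comSign_symm r b,
            comSign_symm r c]
          simp only [Matrix.smul_mul, Matrix.mul_smul, smul_smul, Complex.ofReal_mul]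
          ring_nf

/-- For `b` and `b'` other than `0` and `a`, some Pauli operator commutes with `a` and anticommutes
with `b` and `b'`. -/
theorem exists_comSign {a b b' : PauliLabel n} (hb : b ≠ 0) (hb' : b' ≠ 0) (hab : a ≠ b)
    (hab' : a ≠ b') : ∃ r, comSign a r = 1 ∧ comSign b r = -1 ∧ comSign b' r = -1 := by
  by_contra! h
  -- This product is 8 on the sought r and 0 elsewhere. Its sum over r is at least 4^n by
  -- orthogonality of the signs, so it cannot vanish identically.
  have h0 : ∀ r, (1 + comSign a r) * (1 - comSign b r) * (1 - comSign b' r) = 0 := by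
    intro r
    rcases comSign_eq_or a r with h1 | h1 <;> rcases comSign_eq_or b r with h2 | h2 <;>
      rcases comSign_eq_or b' r with h3 | h3 <;> simp [h1, h2, h3]
    exact h r h1 h2 h3
  have h1 : ∑ r, (1 + comSign a r) * (1 - comSign b r) * (1 - comSign b' r) = 0 :=
    Finset.sum_eq_zero fun r _ => h0 r
  have h2 : ∑ r, (1 + comSign a r) * (1 - comSign b r) * (1 - comSign b' r) =
      (4 : ℝ) ^ n + ∑ r, comSign a r - ∑ r, comSign b r - ∑ r, comSign b' r +
      ∑ r, comSign b r * comSign b' r - ∑ r, comSign a r * comSign b r -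
      ∑ r, comSign a r * comSign b' r + ∑ r, comSign a r * comSign b r * comSign b' r := by
    have : ((4 : ℝ) ^ n) = ∑ r : PauliLabel n, 1 := by simp
    rw [this]
    simp only [← Finset.sum_add_distrib, ← Finset.sum_sub_distrib]
    exact Finset.sum_congr rfl fun r _ => by ring
  rw [h1] at h2
  simp only [sum_comSign, sum_comSign_mul, if_neg hb, if_neg hb', if_neg hab, if_neg hab'] at h2
  have h3 := sum_comSign_mul_mul_nonneg a b b'
  have h4 : (0 : ℝ) < 4 ^ n := by positivity
  have h5 : (0 : ℝ) ≤ if a = 0 then (4 : ℝ) ^ n else 0 := by positivity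
  have h6 : (0 : ℝ) ≤ if b = b' then (4 : ℝ) ^ n else 0 := by positivity
  linarith

/-! ### Random Clifford unitaries -/

theorem CliffordModPhase.star_mat_mul (c : CliffordModPhase n) : star c.mat * c.mat = 1 :=
  Matrix.UnitaryGroup.star_mul_self _

theorem CliffordModPhase.mat_mul_star (c : CliffordModPhase n) : c.mat * star c.mat = 1 :=
  mul_eq_one_comm.1 c.star_mat_mul

theorem CliffordModPhase.conj_mem (c : CliffordModPhase n) (a : PauliLabel n) :
    c.mat * pauliOp a * star c.mat ∈ signedPaulis n :=
  (Quotient.out c : cliffordGroup n).2 a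

instance phases_normal (n : ℕ) : (phases n).Normal := by
  refine ⟨fun U hU V => ?_⟩
  obtain ⟨c, hc⟩ := hU
  have h : V * U * V⁻¹ = U := by
    have : V * U = U * V := by
      apply Subtype.ext; apply Subtype.ext
      change (V.1.1 * U.1.1 : Op n) = U.1.1 * V.1.1
      rw [hc]; simp
    rw [this, mul_inv_cancel_right]
  rw [h]; exact ⟨c, hc⟩

instance (n : ℕ) : Nonempty (CliffordModPhase n) :=
  ⟨(QuotientGroup.mk (1 : cliffordGroup n) : cliffordGroup n ⧸ phases n)⟩

/-- Composition with a fixed Clifford unitary permutes the circuits. -/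
def mulRightEquiv (V : cliffordGroup n) : CliffordModPhase n ≃ CliffordModPhase n :=
  show (cliffordGroup n ⧸ phases n) ≃ (cliffordGroup n ⧸ phases n) from
    Equiv.mulRight (QuotientGroup.mk V)

/-- The chosen representative of a product of classes need not be the product of the
representatives, but the two differ by a scalar k with |k| = 1, which cancels in a conjugation. -/
theorem mulRightEquiv_conj (V : cliffordGroup n) (c : CliffordModPhase n) (A : Op n) :
    (mulRightEquiv V c).mat * A * star (mulRightEquiv V c).mat =
      c.mat * ((V.1.1 : Op n) * A * star (V.1.1 : Op n)) * star c.mat := by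
  have hcl : QuotientGroup.mk (s := phases n) (Quotient.out (mulRightEquiv V c)) =
      QuotientGroup.mk (s := phases n) ((Quotient.out c : cliffordGroup n) * V) := by
    rw [QuotientGroup.mk_mul]
    refine (Quotient.out_eq (mulRightEquiv V c)).trans ?_
    exact congrArg (fun x : cliffordGroup n ⧸ phases n => x * QuotientGroup.mk V)
      (show (c : cliffordGroup n ⧸ phases n) = QuotientGroup.mk (Quotient.out c) from
        (Quotient.out_eq c).symm)
  rw [QuotientGroup.eq] at hcl
  obtain ⟨k, hk⟩ := hcl
  replace hk : star (mulRightEquiv V c).mat * (c.mat * (V.1.1 : Op n)) = k • (1 : Op n) := hk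
  have hV : (V.1.1 : Op n) * star (V.1.1 : Op n) = 1 :=
    mul_eq_one_comm.1 (Matrix.UnitaryGroup.star_mul_self V.1)
  have h1 : c.mat * (V.1.1 : Op n) = k • (mulRightEquiv V c).mat := by
    have := congrArg (fun B => (mulRightEquiv V c).mat * B) hk
    simpa [← mul_assoc, (mulRightEquiv V c).mat_mul_star] using this
  have h2 : k * star k = 1 := by
    have h3 : (c.mat * (V.1.1 : Op n)) * star (c.mat * (V.1.1 : Op n)) = 1 := by
      rw [star_mul]
      calc _ = c.mat * ((V.1.1 : Op n) * star (V.1.1 : Op n)) * star c.mat := by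
            simp only [mul_assoc]
        _ = 1 := by rw [hV, mul_one, c.mat_mul_star]
    rw [h1, star_smul, Matrix.smul_mul, Matrix.mul_smul, smul_smul,
      (mulRightEquiv V c).mat_mul_star] at h3
    have := congrFun (congrFun h3 0) 0
    simpa using this
  have h4 : c.mat * ((V.1.1 : Op n) * A * star (V.1.1 : Op n)) * star c.mat =
      (c.mat * (V.1.1 : Op n)) * A * star (c.mat * (V.1.1 : Op n)) := by
    rw [star_mul]; simp only [mul_assoc]
  rw [h4, h1, star_smul, Matrix.smul_mul, Matrix.smul_mul, Matrix.mul_smul, smul_smul, h2,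
    one_smul]

/-- A unitary Hermitian multiple of a Pauli operator is a signed Pauli operator. -/
theorem smul_pauliOp_mem {z : ℂ} (hz : ‖z‖ = 1) {a : PauliLabel n}
    (h : star (z • pauliOp a) = z • pauliOp a) : z • pauliOp a ∈ signedPaulis n := by
  rw [star_smul, pauliOp_star] at h
  have h1 := congrArg (fun B => (B * pauliOp a).trace) h
  simp only [Matrix.smul_mul, pauliOp_mul_self, Matrix.trace_smul, trace_one_op,
    smul_eq_mul] at h1
  have h2 : (starRingEnd ℂ) z = z := mul_right_cancel₀ (pow_ne_zero n two_ne_zero) h1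
  obtain ⟨x, rfl⟩ := Complex.conj_eq_iff_real.1 h2
  rw [Complex.norm_real, Real.norm_eq_abs] at hz
  rcases eq_or_eq_neg_of_abs_eq hz with rfl | rfl
  · exact ⟨a, Or.inl (by simp)⟩
  · exact ⟨a, Or.inr (by simp)⟩

/-! ### Clifford unitaries that exchange two anticommuting Paulis -/

theorem sq_inv_sqrt_two : ((Real.sqrt 2 : ℂ)⁻¹) * (Real.sqrt 2 : ℂ)⁻¹ = 1 / 2 := by
  rw [← mul_inv, ← Complex.ofReal_mul, Real.mul_self_sqrt (by norm_num)]
  norm_num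

/-- For anticommuting `b` and `b'`, the operator `(P_b + P_b') / √2`. -/
noncomputable def swapOp (b b' : PauliLabel n) : Op n :=
  (Real.sqrt 2 : ℂ)⁻¹ • (pauliOp b + pauliOp b')

theorem star_swapOp (b b' : PauliLabel n) : star (swapOp b b') = swapOp b b' := by
  simp only [swapOp, star_smul, star_add, pauliOp_star]
  congr 1
  simp [Complex.conj_ofReal]

theorem swapOp_conj {b b' : PauliLabel n} (h : comSign b b' = -1) (e : PauliLabel n) :
    swapOp b b' * pauliOp e * swapOp b b' =
      ((comSign b e + comSign b' e : ℝ) / 2 : ℂ) • pauliOp e +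
      ((comSign b e - comSign b' e : ℝ) / 2 : ℂ) • (pauliOp e * pauliOp b * pauliOp b') := by
  have h1 : pauliOp b * pauliOp e * pauliOp b' =
      (comSign b e : ℂ) • (pauliOp e * pauliOp b * pauliOp b') := by
    rw [pauliOp_mul_comm b e, Matrix.smul_mul]
  have h2 : pauliOp b' * pauliOp e * pauliOp b =
      (-comSign b' e : ℂ) • (pauliOp e * pauliOp b * pauliOp b') := by
    rw [pauliOp_mul_comm b' e, Matrix.smul_mul, mul_assoc, pauliOp_mul_comm b' b, comSign_symm b' b,
      h, mul_assoc]
    simp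
  calc swapOp b b' * pauliOp e * swapOp b b'
      = ((Real.sqrt 2 : ℂ)⁻¹ * (Real.sqrt 2 : ℂ)⁻¹) •
        (pauliOp b * pauliOp e * pauliOp b + pauliOp b' * pauliOp e * pauliOp b' +
          (pauliOp b * pauliOp e * pauliOp b' + pauliOp b' * pauliOp e * pauliOp b)) := by
        simp only [swapOp, Matrix.smul_mul, Matrix.mul_smul, smul_smul]
        congr 1
        simp only [mul_add, add_mul]; abel
    _ = _ := by
        rw [sq_inv_sqrt_two, h1, h2, pauliOp_conj, pauliOp_conj, ← add_smul, ← add_smul,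
          smul_add, smul_smul, smul_smul]
        push_cast
        congr 2 <;> ring

theorem swapOp_mul_self {b b' : PauliLabel n} (h : comSign b b' = -1) :
    swapOp b b' * swapOp b b' = 1 := by
  have := swapOp_conj h 0
  simpa [pauliOp_zero] using this

/-- By `swapOp_conj`, P_e is fixed if it commutes with both b and b', changes sign if it
anticommutes with both, and otherwise becomes ±P_e P_b P_b'. The last is a unimodular multiple of a
Pauli and Hermitian, so the multiple is ±1. -/
theorem swapOp_conj_mem {b b' : PauliLabel n} (h : comSign b b' = -1) (e : PauliLabel n) :
    swapOp b b' * pauliOp e * star (swapOp b b') ∈ signedPaulis n := by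
  rw [star_swapOp]
  have hself : star (swapOp b b' * pauliOp e * swapOp b b') =
      swapOp b b' * pauliOp e * swapOp b b' := by
    simp [star_mul, star_swapOp, mul_assoc]
  obtain ⟨z, f, hz, hf⟩ := pauliOp_mul e b
  obtain ⟨w, g, hw, hg⟩ := pauliOp_mul f b'
  have hprod : pauliOp e * pauliOp b * pauliOp b' = (z * w) • pauliOp g := by
    rw [hf, Matrix.smul_mul, hg, smul_smul]
  have hnorm : ‖z * w‖ = 1 := by rw [norm_mul, hz, hw, one_mul]
  rw [swapOp_conj h, hprod, smul_smul] at hself ⊢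
  rcases comSign_eq_or b e with h1 | h1 <;> rcases comSign_eq_or b' e with h2 | h2
  · rw [h1, h2]; exact ⟨e, Or.inl (by norm_num)⟩
  · rw [h1, h2] at hself ⊢
    have e1 : (((1 : ℝ) + (-1 : ℝ) : ℝ) / 2 : ℂ) = 0 := by norm_num
    have e2 : (((1 : ℝ) - (-1 : ℝ) : ℝ) / 2 : ℂ) = 1 := by norm_num
    rw [e1, e2, zero_smul, zero_add, one_mul] at hself ⊢
    exact smul_pauliOp_mem hnorm hself
  · rw [h1, h2] at hself ⊢
    have e1 : (((-1 : ℝ) + (1 : ℝ) : ℝ) / 2 : ℂ) = 0 := by norm_num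
    have e2 : (((-1 : ℝ) - (1 : ℝ) : ℝ) / 2 : ℂ) = -1 := by norm_num
    rw [e1, e2, zero_smul, zero_add] at hself ⊢
    exact smul_pauliOp_mem (by simpa using hnorm) hself
  · rw [h1, h2]; exact ⟨e, Or.inr (by norm_num)⟩

/-- The Clifford unitary `(P_b + P_b') / √2` for anticommuting `b` and `b'`. -/
noncomputable def swapClifford {b b' : PauliLabel n} (h : comSign b b' = -1) : cliffordGroup n :=
  ⟨⟨swapOp b b', by
    rw [Matrix.mem_unitaryGroup_iff, star_swapOp, swapOp_mul_self h]⟩, swapOp_conj_mem h⟩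

/-! ### Diagonalization of Paulis by a circuit -/

open Classical in
/-- The indicator of the event that the circuit `c` diagonalizes the Pauli operator `a`. -/
noncomputable def diagInd (c : CliffordModPhase n) (a : PauliLabel n) : ℝ :=
  if (c.mat * pauliOp a * star c.mat).IsDiag then 1 else 0

theorem diagInd_eq_or (c : CliffordModPhase n) (a : PauliLabel n) :
    diagInd c a = 0 ∨ diagInd c a = 1 := by
  unfold diagInd; split_ifs <;> simp

theorem diagInd_mul_self (c : CliffordModPhase n) (a : PauliLabel n) :
    diagInd c a * diagInd c a = diagInd c a := by
  rcases diagInd_eq_or c a with h | h <;> simp [h]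

theorem sum_diag_mul_diag {E : Op n} (hE : E.IsDiag) (F : Op n) :
    ∑ s, E s s * F s s = (E * F).trace := by
  simp only [Matrix.trace, Matrix.diag_apply, Matrix.mul_apply]
  refine Finset.sum_congr rfl fun s _ => ?_
  rw [Finset.sum_eq_single s]
  · intro t _ ht; rw [hE ht.symm, zero_mul]
  · simp

theorem isDiag_mul_diag {E : Op n} (hE : E.IsDiag) (F : Op n) (s : Bits n) :
    (E * F) s s = E s s * F s s := by
  rw [Matrix.mul_apply, Finset.sum_eq_single s]
  · intro t _ ht; rw [hE ht.symm, zero_mul]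
  · simp

theorem conj_mul_conj (c : CliffordModPhase n) (A B : Op n) :
    (c.mat * A * star c.mat) * (c.mat * B * star c.mat) = c.mat * (A * B) * star c.mat := by
  calc _ = c.mat * A * (star c.mat * c.mat) * B * star c.mat := by simp only [mul_assoc]
    _ = _ := by rw [c.star_mat_mul, mul_one]; simp only [mul_assoc]

theorem trace_conj (c : CliffordModPhase n) (A : Op n) :
    (c.mat * A * star c.mat).trace = A.trace := by
  rw [Matrix.trace_mul_comm, ← mul_assoc, c.star_mat_mul, one_mul]

/-- If the conjugated Pauli is diagonal, the sum over s is a trace, which is invariant under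
conjugation; otherwise the conjugated Pauli has zero diagonal and every term vanishes. -/
theorem sum_bornValue_mul (c : CliffordModPhase n) (a : PauliLabel n) (A : Op n) :
    ∑ s, bornValue (pauliOp a) c.mat s * bornValue A c.mat s =
      (diagInd c a : ℂ) * (pauliOp a * A).trace := by
  unfold diagInd bornValue
  split_ifs with h
  · rw [sum_diag_mul_diag h, conj_mul_conj, trace_conj]; simp
  · have := (signedPaulis_isDiag_or (c.conj_mem a)).resolve_left h
    simp [this]

theorem sum_bornValue_mul_mul (c : CliffordModPhase n) (a b : PauliLabel n) (A : Op n) :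
    ∑ s, bornValue (pauliOp a) c.mat s * bornValue (pauliOp b) c.mat s * bornValue A c.mat s =
      (diagInd c a * diagInd c b : ℂ) * (pauliOp a * pauliOp b * A).trace := by
  unfold diagInd bornValue
  split_ifs with h h'
  · simp only [mul_assoc _ ((c.mat * pauliOp b * star c.mat) _ _), ← isDiag_mul_diag h']
    rw [sum_diag_mul_diag h, conj_mul_conj, conj_mul_conj, trace_conj]; simp [mul_assoc]
  · have := (signedPaulis_isDiag_or (c.conj_mem b)).resolve_left h'
    simp [this]
  · have := (signedPaulis_isDiag_or (c.conj_mem a)).resolve_left h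
    simp [this]
  · have := (signedPaulis_isDiag_or (c.conj_mem a)).resolve_left h
    simp [this]

/-- The outcome `s` of the circuit `c` projects on the state `snapshot c.mat s`. -/
theorem bornValue_eq_trace (A U : Op n) (s : Bits n) :
    bornValue A U s = (A * snapshot U s).trace := by
  have h : (A * snapshot U s).trace = ((U * A * star U) * Matrix.single s s 1).trace := by
    rw [snapshot, ← mul_assoc, Matrix.trace_mul_comm]
    simp only [mul_assoc]
  rw [h, bornValue, Matrix.trace_mul_single]
  simp

theorem snapshot_mul_self (c : CliffordModPhase n) (s : Bits n) :
    snapshot c.mat s * snapshot c.mat s = snapshot c.mat s := by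
  calc _ = star c.mat * Matrix.single s s 1 * (c.mat * star c.mat) * Matrix.single s s 1 *
        c.mat := by simp only [snapshot, mul_assoc]
    _ = _ := by
      rw [c.mat_mul_star, mul_one, mul_assoc _ (Matrix.single s s 1) (Matrix.single s s 1),
        Matrix.single_mul_single_same, one_mul, snapshot]

theorem trace_snapshot (c : CliffordModPhase n) (s : Bits n) : (snapshot c.mat s).trace = 1 := by
  rw [snapshot, Matrix.trace_mul_comm, ← mul_assoc, c.mat_mul_star, one_mul,
    Matrix.trace_single_eq_same]

/-- Applying `sum_bornValue_mul` to P_a itself gives d · `diagInd c a` = Σ_s Tr(P_a Π_s)², with Π_s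
the snapshots. Summed over a, Parseval turns this into d Σ_s Tr Π_s² = d², as the Π_s are d
projections of trace one. -/
theorem sum_diagInd (c : CliffordModPhase n) : ∑ a, diagInd c a = (2 : ℝ) ^ n := by
  have h1 : ∀ a, (diagInd c a : ℂ) * 2 ^ n =
      ∑ s, (pauliOp a * snapshot c.mat s).trace * (pauliOp a * snapshot c.mat s).trace := by
    intro a
    rw [← trace_one_op, ← pauliOp_mul_self a, ← sum_bornValue_mul]
    simp only [bornValue_eq_trace]
  have h2 : (∑ a, (diagInd c a : ℂ)) * 2 ^ n = 2 ^ n * 2 ^ n := by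
    rw [Finset.sum_mul]
    simp only [h1]
    rw [Finset.sum_comm]
    simp only [sum_trace_mul_trace, snapshot_mul_self, trace_snapshot]
    simp
  have h3 := mul_right_cancel₀ (pow_ne_zero n two_ne_zero) h2
  exact_mod_cast h3

theorem diagInd_zero (c : CliffordModPhase n) : diagInd c 0 = 1 := by
  rw [diagInd, if_pos]
  rw [pauliOp_zero, mul_one, c.mat_mul_star]
  exact Matrix.isDiag_one

/-! ### The two-point function of random Clifford circuits -/

/-- The probability that a random circuit diagonalizes both `a` and `b`. -/
noncomputable def jointProb (a b : PauliLabel n) : ℝ :=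
  (Fintype.card (CliffordModPhase n) : ℝ)⁻¹ * ∑ c : CliffordModPhase n, diagInd c a * diagInd c b

theorem diagInd_mulRight {V : cliffordGroup n} {a b : PauliLabel n}
    (h : (V.1.1 : Op n) * pauliOp a * star (V.1.1 : Op n) = pauliOp b ∨
      (V.1.1 : Op n) * pauliOp a * star (V.1.1 : Op n) = -pauliOp b) (c : CliffordModPhase n) :
    diagInd (mulRightEquiv V c) a = diagInd c b := by
  have hiff : ((mulRightEquiv V c).mat * pauliOp a * star (mulRightEquiv V c).mat).IsDiag ↔
      (c.mat * pauliOp b * star c.mat).IsDiag := by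
    rw [mulRightEquiv_conj]
    rcases h with h | h
    · rw [h]
    · rw [h, mul_neg, neg_mul, Matrix.isDiag_neg_iff]
  unfold diagInd
  by_cases h' : (c.mat * pauliOp b * star c.mat).IsDiag
  · rw [if_pos (hiff.2 h'), if_pos h']
  · rw [if_neg (mt hiff.1 h'), if_neg h']

theorem jointProb_comm (a b : PauliLabel n) : jointProb a b = jointProb b a := by
  unfold jointProb
  congr 1
  exact Finset.sum_congr rfl fun c _ => mul_comm _ _

theorem jointProb_self (a : PauliLabel n) : jointProb a a = jointProb 0 a := by
  simp only [jointProb, diagInd_mul_self, diagInd_zero, one_mul]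

theorem jointProb_zero_zero : jointProb (0 : PauliLabel n) 0 = 1 := by
  simp [jointProb, diagInd_zero]

theorem sum_jointProb (a : PauliLabel n) : ∑ b, jointProb a b = 2 ^ n * jointProb 0 a := by
  simp only [jointProb, diagInd_zero, one_mul]
  rw [← Finset.mul_sum, Finset.sum_comm]
  simp only [← Finset.mul_sum, sum_diagInd]
  rw [← Finset.sum_mul]; ring

/-- Diagonal matrices commute, so no circuit diagonalizes two anticommuting operators. -/
theorem jointProb_anticomm {a b : PauliLabel n} (h : comSign a b = -1) : jointProb a b = 0 := by
  have h0 : ∀ c : CliffordModPhase n, diagInd c a * diagInd c b = 0 := by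
    intro c
    by_contra hne
    have ha : (c.mat * pauliOp a * star c.mat).IsDiag := by
      by_contra h'; exact hne (by simp [diagInd, h'])
    have hb : (c.mat * pauliOp b * star c.mat).IsDiag := by
      by_contra h'; exact hne (by simp [diagInd, h'])
    have hcomm : c.mat * (pauliOp a * pauliOp b) * star c.mat =
        c.mat * (pauliOp b * pauliOp a) * star c.mat := by
      rw [← conj_mul_conj, ← conj_mul_conj, ← ha.diagonal_diag, ← hb.diagonal_diag,
        Matrix.diagonal_mul_diagonal, Matrix.diagonal_mul_diagonal]
      simp only [mul_comm]
    have h2 : pauliOp a * pauliOp b = pauliOp b * pauliOp a := by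
      have := congrArg (fun B => star c.mat * B * c.mat) hcomm
      have h3 : ∀ B : Op n, star c.mat * (c.mat * B * star c.mat) * c.mat = B := fun B => by
        calc _ = (star c.mat * c.mat) * B * (star c.mat * c.mat) := by simp only [mul_assoc]
          _ = B := by rw [c.star_mat_mul, one_mul, mul_one]
      simpa only [h3] using this
    rw [comSign, if_pos h2] at h
    norm_num at h
  simp [jointProb, h0]

/-- The Clifford (P_b + P_b')/√2 fixes P_a and carries P_b to P_b', and composing with it permutes
the circuits. -/
theorem jointProb_eq_of_anticomm {a b b' : PauliLabel n} (h : comSign b b' = -1)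
    (hb : comSign a b = 1) (hb' : comSign a b' = 1) : jointProb a b = jointProb a b' := by
  have h1 : swapOp b b' * pauliOp a * star (swapOp b b') = pauliOp a := by
    rw [star_swapOp, swapOp_conj h, comSign_symm b a, comSign_symm b' a, hb, hb']
    norm_num
  have h2 : swapOp b b' * pauliOp b * star (swapOp b b') = pauliOp b' := by
    rw [star_swapOp, swapOp_conj h, comSign_symm b' b, h, comSign_self, pauliOp_mul_self]
    norm_num
  unfold jointProb
  congr 1
  refine (Equiv.sum_comp (mulRightEquiv (swapClifford h))
    (fun c => diagInd c a * diagInd c b)).symm.trans ?_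
  refine Finset.sum_congr rfl fun c _ => ?_
  exact congrArg₂ (· * ·) (diagInd_mulRight (V := swapClifford h) (Or.inl h1) c)
    (diagInd_mulRight (V := swapClifford h) (Or.inl h2) c)

/-- The Clifford group acts transitively on the Pauli operators that are independent of `a` and
commute with it. -/
theorem jointProb_eq {a b b' : PauliLabel n} (hb0 : b ≠ 0) (hb0' : b' ≠ 0) (hab : a ≠ b)
    (hab' : a ≠ b') (hb : comSign a b = 1) (hb' : comSign a b' = 1) :
    jointProb a b = jointProb a b' := by
  -- Here b and b' may commute, so the exchange goes through an intermediate r that anticommutes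
  -- with both.
  obtain ⟨r, hr, hbr, hbr'⟩ := exists_comSign hb0 hb0' hab hab'
  rw [jointProb_eq_of_anticomm hbr hb hr, jointProb_eq_of_anticomm hbr' hb' hr]

theorem four_pow_eq (n : ℕ) : (4 : ℝ) ^ n = 2 ^ n * 2 ^ n := by
  rw [← mul_pow]; norm_num

theorem sum_label_const (x : ℝ) : ∑ _a : PauliLabel n, x = 2 ^ n * 2 ^ n * x := by
  rw [Finset.sum_const, nsmul_eq_mul, Finset.card_univ, Fintype.card_fun, Fintype.card_fin,
    Fintype.card_fin, ← four_pow_eq]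
  push_cast; rfl

theorem sum_label_ite (a : PauliLabel n) (f : PauliLabel n → ℝ) :
    ∑ b, (if b = a then f b else 0) = f a := by
  rw [Finset.sum_eq_single a] <;> simp +contextual

theorem sum_label_ite' (a : PauliLabel n) (f : PauliLabel n → ℝ) :
    ∑ b, (if a = b then f b else 0) = f a := by
  rw [Finset.sum_eq_single a] <;> simp +contextual [eq_comm]

theorem jointProb_zero_left {b : PauliLabel n} (hb : b ≠ 0) :
    jointProb 0 b = ((2 : ℝ) ^ n + 1)⁻¹ := by
  have h1 : ∀ b' : PauliLabel n,
      jointProb 0 b' = jointProb 0 b + (1 - jointProb 0 b) * (if b' = 0 then 1 else 0) := by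
    intro b'
    split_ifs with h
    · rw [h, jointProb_zero_zero]; ring
    · rw [jointProb_eq h hb (Ne.symm h) (Ne.symm hb) (by simp) (by simp)]; ring
  have h2 := sum_jointProb (0 : PauliLabel n)
  rw [jointProb_zero_zero] at h2
  rw [Finset.sum_congr rfl fun b' _ => h1 b'] at h2
  simp only [Finset.sum_add_distrib, ← Finset.mul_sum] at h2
  simp only [sum_label_const, sum_label_ite 0 (fun _ => 1)] at h2
  have hn : n ≠ 0 := by
    rintro rfl
    exact hb (Subsingleton.elim _ _)
  have hd : (2 : ℝ) ≤ 2 ^ n := le_self_pow₀ (by norm_num) hn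
  -- With κ the common value at b ≠ 0, the sum rule reads 1 + (d² - 1)κ = d. The factor d - 1
  -- cancels because b ≠ 0 forces n > 0.
  have h3 : ((2 : ℝ) ^ n - 1) * (jointProb 0 b * ((2 : ℝ) ^ n + 1) - 1) = 0 := by
    linear_combination h2
  rcases mul_eq_zero.1 h3 with h | h
  · linarith
  · rw [← one_div, eq_div_iff (by positivity)]; linarith

theorem jointProb_of_comm {a b : PauliLabel n} (ha : a ≠ 0) (hb : b ≠ 0) (hab : a ≠ b)
    (h : comSign a b = 1) : jointProb a b = 2 / (((2 : ℝ) ^ n + 1) * (2 ^ n + 2)) := by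
  set κ : ℝ := ((2 : ℝ) ^ n + 1)⁻¹ with hκ
  have h1 : ∀ b' : PauliLabel n, jointProb a b' = jointProb a b * ((1 + comSign a b') / 2) +
      (κ - jointProb a b) * ((if b' = 0 then 1 else 0) + (if a = b' then 1 else 0)) := by
    intro b'
    by_cases hb0 : b' = 0
    · rw [hb0, jointProb_comm, jointProb_zero_left ha]
      simp [ha, hκ]
    by_cases hab' : a = b'
    · rw [← hab', jointProb_self, jointProb_zero_left ha]
      simp [ha, hκ]
    rw [if_neg hb0, if_neg hab']
    rcases comSign_eq_or a b' with h' | h'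
    · rw [jointProb_eq hb0 hb hab' hab h' h, h']; ring
    · rw [jointProb_anticomm h', h']; ring
  have h2 := sum_jointProb a
  rw [Finset.sum_congr rfl fun b' _ => h1 b'] at h2
  simp only [Finset.sum_add_distrib, ← Finset.mul_sum, ← Finset.sum_div, sum_comSign,
    jointProb_zero_left ha, if_neg ha] at h2
  simp only [sum_label_const, sum_label_ite 0 (fun _ => 1), sum_label_ite' a (fun _ => 1)] at h2
  -- This is the indicator of the Paulis that commute with a, except 0 and a. It equals 1 at b and
  -- sums to d²/2 - 2, which forces d > 2 and allows the division by d - 2 below.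
  have hnn : ∀ b' : PauliLabel n, 0 ≤ (1 + comSign a b') / 2 -
      ((if b' = 0 then 1 else 0) + (if a = b' then 1 else 0)) := by
    intro b'
    by_cases hb0 : b' = 0
    · simp [hb0, ha]
    by_cases hab' : a = b'
    · simp [← hab', ha]
    rw [if_neg hb0, if_neg hab']
    rcases comSign_eq_or a b' with h' | h' <;> rw [h'] <;> norm_num
  have h3 := Finset.single_le_sum (fun b' _ => hnn b') (Finset.mem_univ b)
  simp only [Finset.sum_sub_distrib, Finset.sum_add_distrib, ← Finset.sum_div, sum_comSign,
    if_neg ha, h, if_neg hb, if_neg hab] at h3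
  simp only [sum_label_const, sum_label_ite 0 (fun _ => 1), sum_label_ite' a (fun _ => 1)] at h3
  have hd : (2 : ℝ) < 2 ^ n := by
    by_contra hd
    have : (0 : ℝ) < 2 ^ n := by positivity
    nlinarith
  have hκ' : κ * ((2 : ℝ) ^ n + 1) = 1 := inv_mul_cancel₀ (by positivity)
  have h4 : ((2 : ℝ) ^ n - 2) * (jointProb a b * ((2 : ℝ) ^ n + 2) - 2 * κ) = 0 := by
    rw [← hκ] at h2
    linear_combination 2 * h2
  rcases mul_eq_zero.1 h4 with h' | h'
  · linarith
  · rw [eq_div_iff (by positivity)]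
    linear_combination ((2 : ℝ) ^ n + 1) * h' + 2 * hκ'

/-- The joint probabilities that a random Clifford unitary diagonalizes two Pauli operators. -/
theorem jointProb_formula (a b : PauliLabel n) :
    jointProb a b = (1 + comSign a b + 2 ^ n * ((if a = 0 then 1 else 0) + (if b = 0 then 1 else 0)
      + (if a = b then 1 else 0)) + 2 ^ n * 2 ^ n * ((if a = 0 then 1 else 0) *
      (if b = 0 then 1 else 0))) / (((2 : ℝ) ^ n + 1) * (2 ^ n + 2)) := by
  have hd : (0 : ℝ) < 2 ^ n := by positivity
  by_cases ha : a = 0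
  · subst ha
    by_cases hb : b = 0
    · subst hb
      rw [jointProb_zero_zero, eq_div_iff (by positivity)]
      simp; ring
    · rw [jointProb_zero_left hb, if_neg (Ne.symm hb), if_neg hb]
      simp; field_simp; ring
  · by_cases hb : b = 0
    · subst hb
      rw [jointProb_comm, jointProb_zero_left ha]
      simp [ha]; field_simp; ring
    · by_cases hab : a = b
      · subst hab
        rw [jointProb_self, jointProb_zero_left ha]
        simp [ha]; field_simp; ring
      · rcases comSign_eq_or a b with h | h
        · rw [jointProb_of_comm ha hb hab h, h]
          simp [ha, hb, hab]; norm_num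
        · rw [jointProb_anticomm h, h]
          simp [ha, hb, hab]

open scoped ComplexOrder

/-! ### The measurement channel -/

theorem ext_trace_pauliOp {A B : Op n}
    (h : ∀ a, (pauliOp a * A).trace = (pauliOp a * B).trace) : A = B := by
  have hA := sum_trace_smul_pauliOp A
  simp only [h, sum_trace_smul_pauliOp B] at hA
  exact (smul_right_injective (Op n) (pow_ne_zero n (two_ne_zero (α := ℂ))) hA).symm

theorem two_pow_add_one_ne_zero (n : ℕ) : ((2 : ℂ) ^ n + 1) ≠ 0 := by
  have : ((2 ^ n + 1 : ℕ) : ℂ) ≠ 0 := Nat.cast_ne_zero.2 (by positivity)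
  exact_mod_cast this

theorem avg_diagInd (a : PauliLabel n) :
    (Fintype.card (CliffordModPhase n) : ℂ)⁻¹ * ∑ c : CliffordModPhase n, (diagInd c a : ℂ) =
      (jointProb 0 a : ℂ) := by
  simp only [jointProb, diagInd_zero, one_mul]
  push_cast; rfl

/-- By `sum_bornValue_mul` the channel is diagonal in the Pauli basis with eigenvalues `jointProb 0
a`, namely 1 at the identity and 1/(d+1) elsewhere. -/
theorem measurementChannel_apply (A : Op n) :
    measurementChannel n A = ((2 : ℂ) ^ n + 1)⁻¹ • (A + A.trace • (1 : Op n)) := by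
  refine ext_trace_pauliOp fun a => ?_
  have h1 : (pauliOp a * measurementChannel n A).trace =
      (jointProb 0 a : ℂ) * (pauliOp a * A).trace := by
    change (pauliOp a * ((Fintype.card (CliffordModPhase n) : ℂ)⁻¹ •
      ∑ c : CliffordModPhase n, ∑ s : Bits n, bornValue A c.mat s • snapshot c.mat s)).trace = _
    simp only [Matrix.mul_smul, Matrix.trace_smul, Finset.mul_sum, Matrix.trace_sum, smul_eq_mul]
    simp only [← bornValue_eq_trace, mul_comm (bornValue A _ _), sum_bornValue_mul,
      ← Finset.mul_sum, ← Finset.sum_mul]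
    rw [← mul_assoc, avg_diagInd]
  have hd := two_pow_add_one_ne_zero n
  rw [h1, Matrix.mul_smul, Matrix.trace_smul, mul_add, Matrix.trace_add, Matrix.mul_smul,
    Matrix.trace_smul, mul_one, trace_pauliOp, smul_eq_mul, smul_eq_mul]
  by_cases ha : a = 0
  · rw [ha, jointProb_zero_zero, if_pos rfl, pauliOp_zero, one_mul]
    push_cast; field_simp; ring
  · rw [jointProb_zero_left ha, if_neg ha]
    push_cast; ring

theorem avg_sum_bornValue_mul (A B : Op n) :
    (Fintype.card (CliffordModPhase n) : ℂ)⁻¹ * ∑ c : CliffordModPhase n, ∑ s,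
      bornValue A c.mat s * bornValue B c.mat s =
      ((A * B).trace + A.trace * B.trace) / ((2 : ℂ) ^ n + 1) := by
  have h : (Fintype.card (CliffordModPhase n) : ℂ)⁻¹ * ∑ c : CliffordModPhase n, ∑ s,
      bornValue A c.mat s * bornValue B c.mat s = (A * measurementChannel n B).trace := by
    change _ = (A * ((Fintype.card (CliffordModPhase n) : ℂ)⁻¹ •
      ∑ c : CliffordModPhase n, ∑ s : Bits n, bornValue B c.mat s • snapshot c.mat s)).trace
    simp only [Matrix.mul_smul, Matrix.trace_smul, Finset.mul_sum, Matrix.trace_sum, smul_eq_mul]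
    simp only [← bornValue_eq_trace, mul_comm (bornValue A _ _)]
  rw [h, measurementChannel_apply, Matrix.mul_smul, Matrix.trace_smul, mul_add, Matrix.trace_add,
    Matrix.mul_smul, Matrix.trace_smul, mul_one, smul_eq_mul, smul_eq_mul]
  ring

/-- The inverse of the measurement channel. -/
noncomputable def inverseChannel (n : ℕ) : Module.End ℂ (Op n) where
  toFun A := ((2 : ℂ) ^ n + 1) • A - A.trace • (1 : Op n)
  map_add' A B := by rw [Matrix.trace_add]; module
  map_smul' z A := by rw [Matrix.trace_smul, RingHom.id_apply, smul_eq_mul]; module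

/-- The measurement channel as a unit of the ring of linear maps. -/
noncomputable def measurementUnit (n : ℕ) : (Module.End ℂ (Op n))ˣ where
  val := measurementChannel n
  inv := inverseChannel n
  val_inv := by
    refine LinearMap.ext fun A => ?_
    change measurementChannel n (((2 : ℂ) ^ n + 1) • A - A.trace • (1 : Op n)) = A
    have hd := two_pow_add_one_ne_zero n
    rw [measurementChannel_apply, Matrix.trace_sub, Matrix.trace_smul, Matrix.trace_smul,
      trace_one_op, smul_eq_mul, smul_eq_mul]
    rw [inv_smul_eq_iff₀ hd]
    module
  inv_val := by
    refine LinearMap.ext fun A => ?_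
    change ((2 : ℂ) ^ n + 1) • measurementChannel n A -
      (measurementChannel n A).trace • (1 : Op n) = A
    have hd := two_pow_add_one_ne_zero n
    rw [measurementChannel_apply, smul_inv_smul₀ hd, Matrix.trace_smul, Matrix.trace_add,
      Matrix.trace_smul, trace_one_op, smul_eq_mul, smul_eq_mul]
    have : ((2 : ℂ) ^ n + 1)⁻¹ * (A.trace + A.trace * 2 ^ n) = A.trace := by
      field_simp; ring
    rw [this]; abel

theorem isUnit_measurementChannel (n : ℕ) : IsUnit (measurementChannel n) :=
  (measurementUnit n).isUnit

theorem reconstruction_apply (A : Op n) :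
    reconstruction n A = ((2 : ℂ) ^ n + 1) • A - A.trace • (1 : Op n) := by
  have : reconstruction n = inverseChannel n := Ring.inverse_unit (measurementUnit n)
  rw [this]; rfl

/-! ### Hermitian operators -/

/-- The Born values of a Hermitian operator are real. -/
noncomputable def bornReal (A : Op n) (c : CliffordModPhase n) (s : Bits n) : ℝ :=
  (bornValue A c.mat s).re

theorem bornValue_eq_ofReal {A : Op n} (hA : star A = A) (c : CliffordModPhase n) (s : Bits n) :
    bornValue A c.mat s = (bornReal A c s : ℂ) := by
  have h : star (c.mat * A * star c.mat) = c.mat * A * star c.mat := by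
    simp [star_mul, hA, mul_assoc]
  exact (Complex.conj_eq_iff_re.1 (congrFun (congrFun h s) s)).symm

/-- The coefficients `Tr (P A)` of a Hermitian operator in the Pauli basis. -/
noncomputable def pauliCoeff (A : Op n) (a : PauliLabel n) : ℝ := (pauliOp a * A).trace.re

theorem trace_mul_eq_ofReal {A B : Op n} (hA : star A = A) (hB : star B = B) :
    (A * B).trace = ((A * B).trace.re : ℂ) := by
  refine (Complex.conj_eq_iff_re.1 ?_).symm
  have := Matrix.trace_conjTranspose (A * B)
  rw [Matrix.conjTranspose_mul, ← Matrix.star_eq_conjTranspose, ← Matrix.star_eq_conjTranspose,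
    hA, hB, Matrix.trace_mul_comm] at this
  exact this.symm

theorem pauliCoeff_eq {A : Op n} (hA : star A = A) (a : PauliLabel n) :
    (pauliOp a * A).trace = (pauliCoeff A a : ℂ) :=
  trace_mul_eq_ofReal (pauliOp_star a) hA

theorem bornValue_sub (A B U : Op n) (s : Bits n) :
    bornValue (A - B) U s = bornValue A U s - bornValue B U s := by
  simp [bornValue, mul_sub, sub_mul]

theorem bornValue_smul (z : ℂ) (A U : Op n) (s : Bits n) :
    bornValue (z • A) U s = z * bornValue A U s := by
  simp [bornValue]

theorem bornValue_sum {ι : Type*} (t : Finset ι) (A : ι → Op n) (U : Op n) (s : Bits n) :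
    bornValue (∑ i ∈ t, A i) U s = ∑ i ∈ t, bornValue (A i) U s := by
  simp [bornValue, Finset.mul_sum, Finset.sum_mul, Matrix.sum_apply]

theorem bornValue_one (c : CliffordModPhase n) (s : Bits n) : bornValue 1 c.mat s = 1 := by
  simp [bornValue, c.mat_mul_star]

theorem sum_bornValue (A : Op n) (c : CliffordModPhase n) :
    ∑ s, bornValue A c.mat s = A.trace := trace_conj c A

theorem sum_bornReal (A : Op n) (c : CliffordModPhase n) :
    ∑ s, bornReal A c s = A.trace.re := by
  rw [← sum_bornValue A c, Complex.re_sum]; rfl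

theorem bornReal_nonneg {A : Op n} (hA : A.PosSemidef) (c : CliffordModPhase n) (s : Bits n) :
    0 ≤ bornReal A c s := by
  have h := (hA.mul_mul_conjTranspose_same c.mat).diag_nonneg (i := s)
  exact (Complex.le_def.1 h).1

theorem bornValue_expand (A : Op n) (U : Op n) (s : Bits n) :
    (2 : ℂ) ^ n * bornValue A U s =
      ∑ a, (pauliOp a * A).trace * bornValue (pauliOp a) U s := by
  rw [← bornValue_smul, ← sum_trace_smul_pauliOp, bornValue_sum]
  simp only [bornValue_smul]

/-! ### Moments of independent samples -/

section Samples

variable {S : Type*} [Fintype S] {R : ℕ}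

theorem sum_prod_weight {p : S → ℝ} (hp : ∑ s, p s = 1) :
    ∑ x : Fin R → S, ∏ k, p (x k) = 1 := by
  classical
  rw [← Fintype.prod_sum (fun (_ : Fin R) s => p s)]
  simp [hp]

theorem sum_prod_weight_mul {p : S → ℝ} (hp : ∑ s, p s = 1) (f : S → ℝ) (k : Fin R) :
    ∑ x : Fin R → S, (∏ j, p (x j)) * f (x k) = ∑ s, p s * f s := by
  classical
  -- Written as a product over all samples, with factor 1 away from k, the sum over x factorizes.
  have h : ∀ x : Fin R → S, (∏ j, p (x j)) * f (x k) =
      ∏ j, (p (x j) * if j = k then f (x j) else 1) := by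
    intro x
    rw [Finset.prod_mul_distrib]
    simp
  simp only [h]
  rw [← Fintype.prod_sum (fun (j : Fin R) s => p s * if j = k then f s else 1),
    Finset.prod_eq_single k]
  · simp
  · intro j _ hj; simp [hj, hp]
  · simp

/-- Cross terms of independent samples vanish: the sum factorizes and its factor at k is the mean of
f, which is 0. -/
theorem sum_prod_weight_mul_mul {p : S → ℝ} (f : S → ℝ) {k l : Fin R}
    (hkl : k ≠ l) (hf : ∑ s, p s * f s = 0) :
    ∑ x : Fin R → S, (∏ j, p (x j)) * (f (x k) * f (x l)) = 0 := by
  classical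
  have h : ∀ x : Fin R → S, (∏ j, p (x j)) * (f (x k) * f (x l)) =
      ∏ j, (p (x j) * ((if j = k then f (x j) else 1) * (if j = l then f (x j) else 1))) := by
    intro x
    rw [Finset.prod_mul_distrib, Finset.prod_mul_distrib]
    simp
  simp only [h]
  rw [← Fintype.prod_sum (fun (j : Fin R) s =>
    p s * ((if j = k then f s else 1) * (if j = l then f s else 1)))]
  refine Finset.prod_eq_zero (Finset.mem_univ k) ?_
  simpa [hkl] using hf

theorem sum_prod_weight_mean {p : S → ℝ} (hp : ∑ s, p s = 1) (hR : 1 ≤ R) (f : S → ℝ) (C : ℝ) :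
    ∑ x : Fin R → S, (∏ j, p (x j)) * ((R : ℝ)⁻¹ * ∑ k, f (x k) + C) = ∑ s, p s * f s + C := by
  have hR0 : (R : ℝ) ≠ 0 := by positivity
  simp only [mul_add, Finset.sum_add_distrib, ← Finset.sum_mul, sum_prod_weight hp, one_mul]
  congr 1
  simp only [mul_left_comm _ (R : ℝ)⁻¹, ← Finset.mul_sum]
  simp only [Finset.mul_sum (s := Finset.univ (α := Fin R))]
  rw [Finset.sum_comm]
  simp only [sum_prod_weight_mul hp]
  simp [hR0]

theorem sum_prod_weight_sq {p : S → ℝ} (hp : ∑ s, p s = 1) (hR : 1 ≤ R) {f : S → ℝ}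
    (hf : ∑ s, p s * f s = 0) (C : ℝ) :
    ∑ x : Fin R → S, (∏ j, p (x j)) * ((R : ℝ)⁻¹ * ∑ k, f (x k) + C) ^ 2 =
      (R : ℝ)⁻¹ * ∑ s, p s * f s ^ 2 + C ^ 2 := by
  have hR0 : (R : ℝ) ≠ 0 := by positivity
  have h1 : ∑ x : Fin R → S, (∏ j, p (x j)) * (∑ k, f (x k)) ^ 2 = R * ∑ s, p s * f s ^ 2 := by
    simp only [sq, Finset.sum_mul_sum]
    simp only [Finset.mul_sum (s := Finset.univ (α := Fin R))]
    rw [Finset.sum_comm]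
    have : ∀ k : Fin R, ∑ x : Fin R → S, ∑ l, (∏ j, p (x j)) * (f (x k) * f (x l)) =
        ∑ s, p s * (f s * f s) := by
      intro k
      rw [Finset.sum_comm, Finset.sum_eq_single k]
      · exact sum_prod_weight_mul hp (fun s => f s * f s) k
      · intro l _ hl; exact sum_prod_weight_mul_mul f (Ne.symm hl) hf
      · simp
    simp [this]
  have h2 := sum_prod_weight_mean hp hR f 0
  rw [hf] at h2
  simp only [add_zero] at h2
  calc _ = ((R : ℝ)⁻¹) ^ 2 * ∑ x : Fin R → S, (∏ j, p (x j)) * (∑ k, f (x k)) ^ 2 +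
        2 * C * ∑ x : Fin R → S, (∏ j, p (x j)) * ((R : ℝ)⁻¹ * ∑ k, f (x k)) +
        C ^ 2 * ∑ x : Fin R → S, ∏ j, p (x j) := by
        simp only [Finset.mul_sum (s := Finset.univ (α := Fin R → S)), ← Finset.sum_add_distrib]
        exact Finset.sum_congr rfl fun x _ => by ring
    _ = _ := by
        rw [h1, h2, sum_prod_weight hp]
        field_simp; ring

end Samples

/-! ### The law of one round -/

instance (n : ℕ) : DiscreteMeasurableSpace (CliffordModPhase n) := ⟨fun _ => trivial⟩

instance (n R : ℕ) : DiscreteMeasurableSpace (Round n R) :=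
  MeasurableSingletonClass.toDiscreteMeasurableSpace

/-- The average over a random circuit. -/
noncomputable def circuitAvg (f : CliffordModPhase n → ℝ) : ℝ :=
  (Fintype.card (CliffordModPhase n) : ℝ)⁻¹ * ∑ c, f c

theorem card_circuits_pos (n : ℕ) : (0 : ℝ) < Fintype.card (CliffordModPhase n) := by
  exact_mod_cast Fintype.card_pos

theorem circuitAvg_const (x : ℝ) : circuitAvg (fun _ : CliffordModPhase n => x) = x := by
  have := card_circuits_pos n
  simp [circuitAvg]

theorem circuitAvg_add (f g : CliffordModPhase n → ℝ) :
    circuitAvg (fun c => f c + g c) = circuitAvg f + circuitAvg g := by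
  simp only [circuitAvg, Finset.sum_add_distrib, mul_add]

theorem circuitAvg_sub (f g : CliffordModPhase n → ℝ) :
    circuitAvg (fun c => f c - g c) = circuitAvg f - circuitAvg g := by
  simp only [circuitAvg, Finset.sum_sub_distrib, mul_sub]

theorem circuitAvg_mul (x : ℝ) (f : CliffordModPhase n → ℝ) :
    circuitAvg (fun c => x * f c) = x * circuitAvg f := by
  simp only [circuitAvg, ← Finset.mul_sum]; ring

theorem circuitAvg_nonneg {f : CliffordModPhase n → ℝ} (hf : ∀ c, 0 ≤ f c) : 0 ≤ circuitAvg f :=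
  mul_nonneg (by positivity) (Finset.sum_nonneg fun c _ => hf c)

theorem circuitAvg_sub_sq (f : CliffordModPhase n → ℝ) :
    circuitAvg (fun c => (f c - circuitAvg f) ^ 2) =
      circuitAvg (fun c => f c ^ 2) - circuitAvg f ^ 2 := by
  have h : (fun c => (f c - circuitAvg f) ^ 2) =
      fun c => (f c ^ 2 - 2 * circuitAvg f * f c) + circuitAvg f ^ 2 := by
    funext c; ring
  rw [h, circuitAvg_add, circuitAvg_sub, circuitAvg_mul, circuitAvg_const]; ring

theorem sq_circuitAvg_le (f : CliffordModPhase n → ℝ) :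
    circuitAvg f ^ 2 ≤ circuitAvg (fun c => f c ^ 2) := by
  have := circuitAvg_sub_sq f
  have h2 := circuitAvg_nonneg (f := fun c => (f c - circuitAvg f) ^ 2) fun c => sq_nonneg _
  linarith

section Law

variable {R : ℕ} {ρ : Op n}

theorem roundWeight_nonneg (hρ : ρ.PosSemidef) (ω : Round n R) :
    0 ≤ (Fintype.card (CliffordModPhase n) : ℝ)⁻¹ * ∏ k, (bornValue ρ ω.1.mat (ω.2 k)).re :=
  mul_nonneg (by positivity) (Finset.prod_nonneg fun _ _ => bornReal_nonneg hρ _ _)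

theorem integral_roundLaw (hρ : ρ.PosSemidef) (f : Round n R → ℝ) :
    ∫ ω, f ω ∂(roundLaw R ρ) =
      circuitAvg fun c => ∑ x : Fin R → Bits n, (∏ k, bornReal ρ c (x k)) * f (c, x) := by
  rw [roundLaw, integral_finsetSum_measure fun ω _ => by
    refine Integrable.smul_measure ?_ ENNReal.ofReal_ne_top
    exact integrable_dirac (by simp)]
  simp only [integral_smul_measure, integral_dirac, ENNReal.toReal_ofReal (roundWeight_nonneg hρ _),
    smul_eq_mul]
  rw [Fintype.sum_prod_type, circuitAvg, Finset.mul_sum]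
  refine Finset.sum_congr rfl fun c _ => ?_
  rw [Finset.mul_sum]
  exact Finset.sum_congr rfl fun x _ => mul_assoc _ _ _

instance (ρ : Op n) : IsFiniteMeasure (roundLaw R ρ) := by
  unfold roundLaw
  refine ⟨?_⟩
  rw [Measure.finsetSum_apply]
  refine ENNReal.sum_lt_top.2 fun ω _ => ?_
  rw [Measure.smul_apply, measure_univ, smul_eq_mul, mul_one]
  exact ENNReal.ofReal_lt_top

theorem isProbabilityMeasure_roundLaw (hρ : ρ.PosSemidef) (hρ1 : ρ.trace = 1) :
    IsProbabilityMeasure (roundLaw R ρ) := by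
  have h := integral_roundLaw (R := R) hρ fun _ => 1
  have h1 : ∀ c : CliffordModPhase n, ∑ s, bornReal ρ c s = 1 := fun c => by
    rw [sum_bornReal, hρ1, Complex.one_re]
  simp only [mul_one, sum_prod_weight (h1 _), circuitAvg_const, integral_const, smul_eq_mul] at h
  refine ⟨?_⟩
  rw [Measure.real, ENNReal.toReal_eq_one_iff] at h
  exact h

end Law

/-! ### Variance of the estimator -/

/-- The inverse channel is A ↦ (d+1)A - Tr(A)𝟙, and a traceless `O` does not see its second term.
Only the first summand depends on the measured outcomes; the other is a function of the circuit. -/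
theorem crmEstimator_eq {R : ℕ} {σ O : Op n} (hσ : star σ = σ) (hO : star O = O)
    (hO0 : O.trace = 0) (ω : Round n R) :
    crmEstimator σ O ω = (R : ℝ)⁻¹ * ∑ k, ((2 : ℝ) ^ n + 1) * bornReal O ω.1 (ω.2 k) +
      ((O * σ).trace.re - ∑ s, bornReal σ ω.1 s * (((2 : ℝ) ^ n + 1) * bornReal O ω.1 s)) := by
  have h1 : ∀ s, (O * reconstruction n (snapshot ω.1.mat s)).trace =
      ((((2 : ℝ) ^ n + 1) * bornReal O ω.1 s : ℝ) : ℂ) := by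
    intro s
    rw [reconstruction_apply, mul_sub, Matrix.trace_sub, Matrix.mul_smul, Matrix.mul_smul,
      Matrix.trace_smul, Matrix.trace_smul, mul_one, hO0, smul_zero, sub_zero,
      ← bornValue_eq_trace, bornValue_eq_ofReal hO]
    push_cast; rfl
  have h2 : (O * (rhoHat ω - sigmaHat σ ω + σ)).trace =
      (((R : ℝ)⁻¹ * ∑ k, ((2 : ℝ) ^ n + 1) * bornReal O ω.1 (ω.2 k) -
        ∑ s, bornReal σ ω.1 s * (((2 : ℝ) ^ n + 1) * bornReal O ω.1 s) : ℝ) : ℂ) +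
      (O * σ).trace := by
    rw [mul_add, mul_sub, Matrix.trace_add, Matrix.trace_sub, rhoHat, sigmaHat]
    simp only [Matrix.mul_smul, Matrix.trace_smul, Finset.mul_sum, Matrix.trace_sum, smul_eq_mul,
      h1, bornValue_eq_ofReal hσ]
    push_cast
    rfl
  rw [crmEstimator, h2, Complex.add_re, Complex.ofReal_re]
  ring

/-- The mean of the estimator given the circuit, up to a constant. -/
noncomputable def circuitMean (A O : Op n) (c : CliffordModPhase n) : ℝ :=
  ∑ s, bornReal A c s * (((2 : ℝ) ^ n + 1) * bornReal O c s)

theorem bornReal_sub (A B : Op n) (c : CliffordModPhase n) (s : Bits n) :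
    bornReal (A - B) c s = bornReal A c s - bornReal B c s := by
  simp [bornReal, bornValue_sub]

theorem circuitAvg_circuitMean {A O : Op n} (hA : star A = A) (hO : star O = O)
    (hO0 : O.trace = 0) : circuitAvg (circuitMean A O) = (A * O).trace.re := by
  have hd := two_pow_add_one_ne_zero n
  have h := avg_sum_bornValue_mul A O
  simp only [bornValue_eq_ofReal hA, bornValue_eq_ofReal hO, hO0, mul_zero, add_zero] at h
  rw [eq_div_iff hd, trace_mul_eq_ofReal hA hO] at h
  have h2 : circuitAvg (circuitMean A O) = ((Fintype.card (CliffordModPhase n) : ℝ)⁻¹ *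
      ∑ c : CliffordModPhase n, ∑ s, bornReal A c s * bornReal O c s) * (2 ^ n + 1) := by
    unfold circuitAvg circuitMean
    simp only [mul_left_comm _ ((2 : ℝ) ^ n + 1), ← Finset.mul_sum]
    ring
  rw [h2, ← Complex.ofReal_inj, ← h]
  push_cast
  rfl

section Variance

variable {R : ℕ} {σ O ρ : Op n}

theorem integral_crmEstimator (hR : 1 ≤ R) (hσ : star σ = σ) (hO : star O = O) (hO0 : O.trace = 0)
    (hρ : ρ.PosSemidef) (hρ1 : ρ.trace = 1) :
    ∫ ω, crmEstimator (R := R) σ O ω ∂(roundLaw R ρ) = (O * ρ).trace.re := by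
  have hρs : star ρ = ρ := hρ.1
  have h1 : ∀ c : CliffordModPhase n, ∑ s, bornReal ρ c s = 1 := fun c => by
    rw [sum_bornReal, hρ1, Complex.one_re]
  rw [integral_roundLaw hρ]
  simp only [crmEstimator_eq hσ hO hO0]
  have h2 := fun c => sum_prod_weight_mean (h1 c) hR (fun s => ((2 : ℝ) ^ n + 1) * bornReal O c s)
    ((O * σ).trace.re - circuitMean σ O c)
  refine (congrArg circuitAvg (funext h2)).trans ?_
  change circuitAvg (fun c => circuitMean ρ O c + ((O * σ).trace.re - circuitMean σ O c)) = _
  rw [circuitAvg_add, circuitAvg_sub, circuitAvg_const, circuitAvg_circuitMean hρs hO hO0,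
    circuitAvg_circuitMean hσ hO hO0, Matrix.trace_mul_comm O σ, Matrix.trace_mul_comm O ρ]
  ring

/-- The law of total variance for the estimator. -/
theorem crmVariance_eq (hR : 1 ≤ R) (hσ : star σ = σ) (hO : star O = O) (hO0 : O.trace = 0)
    (hρ : ρ.PosSemidef) (hρ1 : ρ.trace = 1) :
    crmVariance R σ O ρ = (R : ℝ)⁻¹ * circuitAvg (fun c =>
        ∑ s, bornReal ρ c s * (((2 : ℝ) ^ n + 1) * bornReal O c s - circuitMean ρ O c) ^ 2) +
      circuitAvg fun c => (circuitMean (ρ - σ) O c - ((ρ - σ) * O).trace.re) ^ 2 := by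
  have h1 : ∀ c : CliffordModPhase n, ∑ s, bornReal ρ c s = 1 := fun c => by
    rw [sum_bornReal, hρ1, Complex.one_re]
  have hR0 : (R : ℝ) ≠ 0 := by positivity
  -- Centring at the conditional mean removes the cross term between outcome noise and circuit
  -- noise.
  have h2 : ∀ c : CliffordModPhase n,
      ∑ s, bornReal ρ c s * (((2 : ℝ) ^ n + 1) * bornReal O c s - circuitMean ρ O c) = 0 := by
    intro c
    simp only [mul_sub, Finset.sum_sub_distrib, ← Finset.sum_mul, h1]
    rw [circuitMean, one_mul, sub_self]
  rw [crmVariance, ProbabilityTheory.variance_eq_integral (Measurable.of_discrete.aemeasurable),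
    integral_crmEstimator hR hσ hO hO0 hρ hρ1, integral_roundLaw hρ, ← circuitAvg_mul,
    ← circuitAvg_add]
  congr 1
  funext c
  rw [← sum_prod_weight_sq (h1 c) hR (h2 c)]
  refine Finset.sum_congr rfl fun x _ => ?_
  congr 2
  rw [crmEstimator_eq hσ hO hO0]
  -- The simulated σ̂ subtracts the conditional mean of σ at the same circuit, so only the
  -- difference ρ - σ fluctuates with the circuit.
  have h3 : circuitMean (ρ - σ) O c = circuitMean ρ O c - circuitMean σ O c := by
    simp only [circuitMean, bornReal_sub, sub_mul, Finset.sum_sub_distrib]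
  rw [h3, Finset.sum_sub_distrib, sub_mul, Matrix.trace_sub, Complex.sub_re,
    Matrix.trace_mul_comm O σ, Matrix.trace_mul_comm O ρ]
  simp only [Finset.sum_const, Finset.card_univ, Fintype.card_fin, nsmul_eq_mul]
  change _ + ((σ * O).trace.re - circuitMean σ O c) - _ = _
  field_simp
  ring

end Variance

/-! ### Moments of the stabilizer states -/

theorem sum_bornValue_sq_mul (c : CliffordModPhase n) (σ ρ : Op n) :
    (2 : ℂ) ^ n * 2 ^ n * ∑ s, bornValue σ c.mat s * bornValue σ c.mat s * bornValue ρ c.mat s =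
      ∑ a, ∑ b, ((diagInd c a : ℂ) * diagInd c b) * ((pauliOp a * σ).trace * (pauliOp b * σ).trace *
        (pauliOp a * pauliOp b * ρ).trace) := by
  have h1 : ∀ s, (2 : ℂ) ^ n * 2 ^ n *
      (bornValue σ c.mat s * bornValue σ c.mat s * bornValue ρ c.mat s) =
      ∑ a, ∑ b, (pauliOp a * σ).trace * (pauliOp b * σ).trace *
        (bornValue (pauliOp a) c.mat s * bornValue (pauliOp b) c.mat s * bornValue ρ c.mat s) := by
    intro s
    calc _ = ((2 : ℂ) ^ n * bornValue σ c.mat s) * ((2 : ℂ) ^ n * bornValue σ c.mat s) *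
          bornValue ρ c.mat s := by ring
      _ = _ := by
        rw [bornValue_expand, Finset.sum_mul_sum, Finset.sum_mul]
        refine Finset.sum_congr rfl fun a _ => ?_
        rw [Finset.sum_mul]
        exact Finset.sum_congr rfl fun b _ => by ring
  rw [Finset.mul_sum, Finset.sum_congr rfl fun s _ => h1 s, Finset.sum_comm]
  refine Finset.sum_congr rfl fun a _ => ?_
  rw [Finset.sum_comm]
  refine Finset.sum_congr rfl fun b _ => ?_
  rw [← Finset.mul_sum, sum_bornValue_mul_mul]
  ring

theorem avg_diagInd_mul (a b : PauliLabel n) :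
    (Fintype.card (CliffordModPhase n) : ℂ)⁻¹ *
      ∑ c : CliffordModPhase n, ((diagInd c a : ℂ) * diagInd c b) = (jointProb a b : ℂ) := by
  unfold jointProb
  push_cast; rfl

theorem sum_csum_ite (a : PauliLabel n) (f : PauliLabel n → ℂ) :
    ∑ b, (if b = a then 1 else 0) * f b = f a := by
  rw [Finset.sum_eq_single a] <;> simp +contextual

theorem sum_csum_ite' (a : PauliLabel n) (f : PauliLabel n → ℂ) :
    ∑ b, (if a = b then 1 else 0) * f b = f a := by
  rw [Finset.sum_eq_single a] <;> simp +contextual [eq_comm]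

/-- The third moment of the stabilizer states for a pure state `σ`. -/
theorem avg_sum_bornValue_sq_mul {σ ρ : Op n} (hσ : σ * σ = σ) (hσ1 : σ.trace = 1)
    (hρ1 : ρ.trace = 1) :
    ((2 : ℂ) ^ n + 1) * (2 ^ n + 2) * ((Fintype.card (CliffordModPhase n) : ℂ)⁻¹ *
      ∑ c : CliffordModPhase n, ∑ s,
        bornValue σ c.mat s * bornValue σ c.mat s * bornValue ρ c.mat s) =
      2 + 4 * (σ * ρ).trace := by
  have hd : (2 : ℂ) ^ n ≠ 0 := pow_ne_zero _ two_ne_zero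
  have hd1 := two_pow_add_one_ne_zero n
  have hd2 : ((2 : ℂ) ^ n + 2) ≠ 0 := by
    have : ((2 ^ n + 2 : ℕ) : ℂ) ≠ 0 := Nat.cast_ne_zero.2 (by positivity)
    exact_mod_cast this
  set T : PauliLabel n → PauliLabel n → ℂ := fun a b => (pauliOp a * σ).trace *
    (pauliOp b * σ).trace * (pauliOp a * pauliOp b * ρ).trace with hT
  have s1 : ∑ a, ∑ b, T a b = (2 : ℂ) ^ n * 2 ^ n * (σ * ρ).trace := by
    have h : ((∑ a, (pauliOp a * σ).trace • pauliOp a) * (∑ b, (pauliOp b * σ).trace • pauliOp b) *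
        ρ).trace = ∑ a, ∑ b, T a b := by
      rw [Finset.sum_mul_sum, Finset.sum_mul, Matrix.trace_sum]
      refine Finset.sum_congr rfl fun a _ => ?_
      rw [Finset.sum_mul, Matrix.trace_sum]
      refine Finset.sum_congr rfl fun b _ => ?_
      simp only [Matrix.smul_mul, Matrix.mul_smul, Matrix.trace_smul, smul_eq_mul, hT]
      ring
    rw [← h, sum_trace_smul_pauliOp]
    simp only [Matrix.smul_mul, Matrix.mul_smul, Matrix.trace_smul, smul_eq_mul, hσ]
    ring
  -- Multiplying T(a,b) by the commutation sign exchanges its arguments, so this double sum equals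
  -- the previous one.
  have s2 : ∑ a, ∑ b, (comSign a b : ℂ) * T a b = (2 : ℂ) ^ n * 2 ^ n * (σ * ρ).trace := by
    rw [← s1, Finset.sum_comm]
    refine Finset.sum_congr rfl fun b _ => Finset.sum_congr rfl fun a _ => ?_
    simp only [hT]
    rw [pauliOp_mul_comm b a, Matrix.smul_mul, Matrix.trace_smul, smul_eq_mul, comSign_symm b a]
    ring
  have s3 : ∑ a, ∑ b, (if a = 0 then (1 : ℂ) else 0) * T a b = 2 ^ n * (σ * ρ).trace := by
    simp only [← Finset.mul_sum]
    rw [sum_csum_ite 0 fun a => ∑ b, T a b]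
    simp only [hT, pauliOp_zero, one_mul, hσ1]
    rw [sum_trace_mul_trace]
  have s4 : ∑ a, ∑ b, (if b = 0 then (1 : ℂ) else 0) * T a b = 2 ^ n * (σ * ρ).trace := by
    simp only [sum_csum_ite 0 (T _)]
    simp only [hT, pauliOp_zero, one_mul, mul_one, hσ1]
    rw [sum_trace_mul_trace]
  have s5 : ∑ a, ∑ b, (if a = b then (1 : ℂ) else 0) * T a b = 2 ^ n := by
    simp only [sum_csum_ite' _ (T _)]
    simp only [hT, pauliOp_mul_self, one_mul, hρ1, mul_one]
    rw [sum_trace_mul_trace, hσ, hσ1, mul_one]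
  have s6 : ∑ a, ∑ b, ((if a = 0 then (1 : ℂ) else 0) * (if b = 0 then 1 else 0)) * T a b = 1 := by
    simp only [mul_assoc, ← Finset.mul_sum, sum_csum_ite 0 (T _)]
    rw [sum_csum_ite 0 fun a => T a 0]
    simp [hT, pauliOp_zero, hσ1, hρ1]
  have key : (2 : ℂ) ^ n * 2 ^ n * ((Fintype.card (CliffordModPhase n) : ℂ)⁻¹ *
      ∑ c : CliffordModPhase n, ∑ s,
        bornValue σ c.mat s * bornValue σ c.mat s * bornValue ρ c.mat s) =
      ∑ a, ∑ b, (jointProb a b : ℂ) * T a b := by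
    rw [mul_left_comm, Finset.mul_sum]
    simp only [sum_bornValue_sq_mul]
    rw [Finset.sum_comm, Finset.mul_sum]
    refine Finset.sum_congr rfl fun a _ => ?_
    rw [Finset.sum_comm, Finset.mul_sum]
    refine Finset.sum_congr rfl fun b _ => ?_
    rw [← Finset.sum_mul, ← mul_assoc, avg_diagInd_mul]
  have h2 : ((2 : ℂ) ^ n + 1) * (2 ^ n + 2) * ∑ a, ∑ b, (jointProb a b : ℂ) * T a b =
      ∑ a, ∑ b, T a b + ∑ a, ∑ b, (comSign a b : ℂ) * T a b +
      2 ^ n * (∑ a, ∑ b, (if a = 0 then (1 : ℂ) else 0) * T a b +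
        ∑ a, ∑ b, (if b = 0 then (1 : ℂ) else 0) * T a b +
        ∑ a, ∑ b, (if a = b then (1 : ℂ) else 0) * T a b) +
      2 ^ n * 2 ^ n * ∑ a, ∑ b, ((if a = 0 then (1 : ℂ) else 0) * (if b = 0 then 1 else 0)) *
        T a b := by
    simp only [Finset.mul_sum, ← Finset.sum_add_distrib]
    refine Finset.sum_congr rfl fun a _ => Finset.sum_congr rfl fun b _ => ?_
    rw [jointProb_formula]
    push_cast [apply_ite Complex.ofReal]
    field_simp
  rw [← key, s1, s2, s3, s4, s5, s6] at h2
  apply mul_left_cancel₀ (mul_ne_zero hd hd)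
  linear_combination h2

/-! ### The two parts of the variance -/

section Parts

variable {σ ρ : Op n}

theorem trace_traceless (hσ1 : σ.trace = 1) :
    (σ - ((2 : ℂ) ^ n)⁻¹ • (1 : Op n)).trace = 0 := by
  have hd : (2 : ℂ) ^ n ≠ 0 := pow_ne_zero _ two_ne_zero
  rw [Matrix.trace_sub, Matrix.trace_smul, trace_one_op, hσ1, smul_eq_mul, inv_mul_cancel₀ hd,
    sub_self]

theorem star_traceless (hσ : star σ = σ) :
    star (σ - ((2 : ℂ) ^ n)⁻¹ • (1 : Op n)) = σ - ((2 : ℂ) ^ n)⁻¹ • (1 : Op n) := by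
  simp [star_sub, hσ, star_smul]

theorem bornReal_traceless (σ : Op n) (c : CliffordModPhase n) (s : Bits n) :
    bornReal (σ - ((2 : ℂ) ^ n)⁻¹ • (1 : Op n)) c s = bornReal σ c s - ((2 : ℝ) ^ n)⁻¹ := by
  have h : (((2 : ℂ) ^ n)⁻¹) = (((2 : ℝ) ^ n)⁻¹ : ℝ) := by push_cast; rfl
  rw [bornReal_sub]
  congr 1
  rw [bornReal, bornValue_smul, bornValue_one, mul_one, h, Complex.ofReal_re]

/-- The contribution of the finite number of measurements per circuit to the variance. -/
theorem outcome_variance_le (hσ : star σ = σ) (hσ2 : σ * σ = σ) (hσ1 : σ.trace = 1)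
    (hρ : ρ.PosSemidef) (hρ1 : ρ.trace = 1) :
    circuitAvg (fun c => ∑ s, bornReal ρ c s * (((2 : ℝ) ^ n + 1) *
      bornReal (σ - ((2 : ℂ) ^ n)⁻¹ • (1 : Op n)) c s -
      circuitMean ρ (σ - ((2 : ℂ) ^ n)⁻¹ • (1 : Op n)) c) ^ 2) ≤ 2 := by
  have hρs : star ρ = ρ := hρ.1
  have h1 : ∀ c : CliffordModPhase n, ∑ s, bornReal ρ c s = 1 := fun c => by
    rw [sum_bornReal, hρ1, Complex.one_re]
  set F : ℝ := (σ * ρ).trace.re with hF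
  have hFc : (σ * ρ).trace = (F : ℂ) := trace_mul_eq_ofReal hσ hρs
  have hd : (0 : ℝ) < 2 ^ n := by positivity
  have e1 : ∀ c : CliffordModPhase n, ∑ s, bornReal ρ c s * (((2 : ℝ) ^ n + 1) *
      bornReal (σ - ((2 : ℂ) ^ n)⁻¹ • (1 : Op n)) c s -
      circuitMean ρ (σ - ((2 : ℂ) ^ n)⁻¹ • (1 : Op n)) c) ^ 2 =
      ((2 : ℝ) ^ n + 1) ^ 2 * ((∑ s, bornReal σ c s * bornReal σ c s * bornReal ρ c s) -
        (∑ s, bornReal ρ c s * bornReal σ c s) ^ 2) := by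
    intro c
    set m := ∑ s, bornReal ρ c s * bornReal σ c s with hm
    have h2 : circuitMean ρ (σ - ((2 : ℂ) ^ n)⁻¹ • (1 : Op n)) c =
        ((2 : ℝ) ^ n + 1) * (m - ((2 : ℝ) ^ n)⁻¹) := by
      simp only [circuitMean, bornReal_traceless, mul_sub, Finset.sum_sub_distrib,
        ← Finset.sum_mul, h1, one_mul, hm, mul_left_comm _ ((2 : ℝ) ^ n + 1), ← Finset.mul_sum]
    have h3 : ∀ s, bornReal ρ c s * (((2 : ℝ) ^ n + 1) *
      bornReal (σ - ((2 : ℂ) ^ n)⁻¹ • (1 : Op n)) c s -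
      circuitMean ρ (σ - ((2 : ℂ) ^ n)⁻¹ • (1 : Op n)) c) ^ 2 =
      ((2 : ℝ) ^ n + 1) ^ 2 * (bornReal σ c s * bornReal σ c s * bornReal ρ c s) -
      ((2 : ℝ) ^ n + 1) ^ 2 * (2 * m) * (bornReal ρ c s * bornReal σ c s) +
      ((2 : ℝ) ^ n + 1) ^ 2 * m ^ 2 * bornReal ρ c s := by
      intro s
      rw [h2, bornReal_traceless]; ring
    simp only [h3, Finset.sum_add_distrib, Finset.sum_sub_distrib, ← Finset.mul_sum, h1, ← hm]
    ring
  have e2 : ((2 : ℝ) ^ n + 1) * (2 ^ n + 2) * circuitAvg (fun c =>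
      ∑ s, bornReal σ c s * bornReal σ c s * bornReal ρ c s) = 2 + 4 * F := by
    have h := avg_sum_bornValue_sq_mul hσ2 hσ1 hρ1
    simp only [bornValue_eq_ofReal hσ, bornValue_eq_ofReal hρs, hFc] at h
    rw [← Complex.ofReal_inj]
    push_cast [circuitAvg]
    exact h
  have e3 : ((2 : ℝ) ^ n + 1) * circuitAvg (fun c => ∑ s, bornReal ρ c s * bornReal σ c s) =
      F + 1 := by
    have h := avg_sum_bornValue_mul ρ σ
    rw [eq_div_iff (two_pow_add_one_ne_zero n), Matrix.trace_mul_comm] at h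
    simp only [bornValue_eq_ofReal hσ, bornValue_eq_ofReal hρs, hFc, hσ1, hρ1, mul_one] at h
    rw [mul_comm, ← Complex.ofReal_inj]
    push_cast [circuitAvg]
    exact h
  simp only [e1]
  rw [circuitAvg_mul, circuitAvg_sub]
  set A := circuitAvg (fun c => ∑ s, bornReal σ c s * bornReal σ c s * bornReal ρ c s) with hA
  have hA0 : 0 ≤ A := circuitAvg_nonneg fun c => Finset.sum_nonneg fun s _ =>
    mul_nonneg (mul_self_nonneg _) (bornReal_nonneg hρ c s)
  have e4 := sq_circuitAvg_le fun c : CliffordModPhase n => ∑ s, bornReal ρ c s * bornReal σ c s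
  set m := circuitAvg (fun c => ∑ s, bornReal ρ c s * bornReal σ c s)
  -- The third moment carries (d+1)(d+2), which is at least (d+1)².
  have e5 : ((2 : ℝ) ^ n + 1) ^ 2 * A ≤ 2 + 4 * F := by
    rw [← e2, sq]
    have : 0 ≤ ((2 : ℝ) ^ n + 1) * A := by positivity
    nlinarith
  have e6 : ((2 : ℝ) ^ n + 1) ^ 2 * m ^ 2 = (F + 1) ^ 2 := by rw [← e3]; ring
  -- Jensen over circuits replaces the average squared mean by (F+1)². The remainder is 2 + 4F -
  -- (1+F)² = 2 - (1-F)².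
  have e7 := mul_le_mul_of_nonneg_left e4 (sq_nonneg ((2 : ℝ) ^ n + 1))
  rw [e6] at e7
  nlinarith [sq_nonneg (F - 1)]

/-- The contribution of the Pauli operator `a` to the infidelity of `ρ` with respect to the pure
state `σ`. -/
noncomputable def infidelityCoeff (σ ρ : Op n) (a : PauliLabel n) : ℝ :=
  -(pauliCoeff σ a * pauliCoeff (ρ - σ) a)

theorem sum_infidelityCoeff (hσ : star σ = σ) (hρ : star ρ = ρ) (hσ2 : σ * σ = σ)
    (hσ1 : σ.trace = 1) :
    ∑ a, infidelityCoeff σ ρ a = 2 ^ n * (1 - (σ * ρ).trace.re) := by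
  have hΔ : star (ρ - σ) = ρ - σ := by rw [star_sub, hσ, hρ]
  have h := sum_trace_mul_trace σ (ρ - σ)
  simp only [pauliCoeff_eq hσ, pauliCoeff_eq hΔ] at h
  rw [mul_sub, Matrix.trace_sub, hσ2, hσ1, trace_mul_eq_ofReal hσ hρ] at h
  have h' : ∑ a, pauliCoeff σ a * pauliCoeff (ρ - σ) a = 2 ^ n * ((σ * ρ).trace.re - 1) := by
    exact_mod_cast h
  simp only [infidelityCoeff, Finset.sum_neg_distrib, h']
  ring

/-- The contribution of the random choice of the circuit to the variance. -/
theorem circuit_variance_eq (hσ : star σ = σ) (hρ : star ρ = ρ) (hσ2 : σ * σ = σ)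
    (hσ1 : σ.trace = 1) (hρ1 : ρ.trace = 1) :
    circuitAvg (fun c => (circuitMean (ρ - σ) (σ - ((2 : ℂ) ^ n)⁻¹ • (1 : Op n)) c -
      ((ρ - σ) * (σ - ((2 : ℂ) ^ n)⁻¹ • (1 : Op n))).trace.re) ^ 2) =
    ((2 : ℝ) ^ n + 1) / ((2 ^ n + 2) * (2 ^ n) ^ 2) * ((2 ^ n * (1 - (σ * ρ).trace.re)) ^ 2 +
      ∑ a, infidelityCoeff σ ρ a * ∑ b, comSign a b * infidelityCoeff σ ρ b +
      2 ^ n * ∑ a, infidelityCoeff σ ρ a ^ 2) - (1 - (σ * ρ).trace.re) ^ 2 := by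
  have hΔ : star (ρ - σ) = ρ - σ := by rw [star_sub, hσ, hρ]
  have hΔ0 : (ρ - σ).trace = 0 := by rw [Matrix.trace_sub, hρ1, hσ1, sub_self]
  have hd : (0 : ℝ) < 2 ^ n := by positivity
  have hdc : (2 : ℂ) ^ n ≠ 0 := pow_ne_zero _ two_ne_zero
  set y := infidelityCoeff σ ρ with hy
  have hsum := sum_infidelityCoeff hσ hρ hσ2 hσ1
  rw [← hy] at hsum
  -- As ρ - σ is traceless, the identity does not contribute, and the terms of `jointProb_formula`
  -- with a = 0 or b = 0 drop out.
  have hy0 : y 0 = 0 := by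
    simp [hy, infidelityCoeff, pauliCoeff, pauliOp_zero, hΔ0, -Matrix.trace_sub]
  set ε := 1 - (σ * ρ).trace.re with hε
  have hmean : ∀ c : CliffordModPhase n,
      circuitMean (ρ - σ) (σ - ((2 : ℂ) ^ n)⁻¹ • (1 : Op n)) c =
      -(((2 : ℝ) ^ n + 1) / 2 ^ n) * ∑ a, diagInd c a * y a := by
    intro c
    have h1 : (2 : ℂ) ^ n * ∑ s, bornValue σ c.mat s * bornValue (ρ - σ) c.mat s =
        ∑ a, (pauliOp a * σ).trace * ((diagInd c a : ℂ) * (pauliOp a * (ρ - σ)).trace) := by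
      simp only [← sum_bornValue_mul, Finset.mul_sum, ← mul_assoc, bornValue_expand σ,
        Finset.sum_mul]
      rw [Finset.sum_comm]
    simp only [bornValue_eq_ofReal hσ, bornValue_eq_ofReal hΔ, pauliCoeff_eq hσ,
      pauliCoeff_eq hΔ] at h1
    have h2 : (2 : ℝ) ^ n * ∑ s, bornReal σ c s * bornReal (ρ - σ) c s =
        ∑ a, pauliCoeff σ a * (diagInd c a * pauliCoeff (ρ - σ) a) := by exact_mod_cast h1
    have h3 : ∑ a, pauliCoeff σ a * (diagInd c a * pauliCoeff (ρ - σ) a) =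
        -∑ a, diagInd c a * y a := by
      rw [← Finset.sum_neg_distrib]
      exact Finset.sum_congr rfl fun a _ => by rw [hy, infidelityCoeff]; ring
    have h4 : ∑ s, bornReal (ρ - σ) c s = 0 := by rw [sum_bornReal, hΔ0, Complex.zero_re]
    have h5 : circuitMean (ρ - σ) (σ - ((2 : ℂ) ^ n)⁻¹ • (1 : Op n)) c =
        ((2 : ℝ) ^ n + 1) * ∑ s, bornReal σ c s * bornReal (ρ - σ) c s := by
      have : ∀ s, bornReal (ρ - σ) c s * (((2 : ℝ) ^ n + 1) * (bornReal σ c s - ((2 : ℝ) ^ n)⁻¹)) =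
          ((2 : ℝ) ^ n + 1) * (bornReal σ c s * bornReal (ρ - σ) c s) -
          ((2 : ℝ) ^ n + 1) * ((2 : ℝ) ^ n)⁻¹ * bornReal (ρ - σ) c s := fun s => by ring
      simp only [circuitMean, bornReal_traceless, this, Finset.sum_sub_distrib, ← Finset.mul_sum,
        h4, mul_zero, sub_zero]
    rw [h5]
    rw [h3] at h2
    field_simp
    linear_combination h2
  have hsq : circuitAvg (fun c : CliffordModPhase n => (∑ a, diagInd c a * y a) ^ 2) =
      ∑ a, ∑ b, jointProb a b * (y a * y b) := by
    unfold circuitAvg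
    simp only [sq, Finset.sum_mul_sum]
    rw [Finset.sum_comm, Finset.mul_sum]
    refine Finset.sum_congr rfl fun a _ => ?_
    rw [Finset.sum_comm, Finset.mul_sum]
    refine Finset.sum_congr rfl fun b _ => ?_
    rw [jointProb, mul_assoc, Finset.sum_mul]
    congr 1
    exact Finset.sum_congr rfl fun c _ => by ring
  have hJ : ∑ a, ∑ b, jointProb a b * (y a * y b) =
      ((∑ a, y a) ^ 2 + ∑ a, y a * ∑ b, comSign a b * y b + 2 ^ n * ∑ a, y a ^ 2) /
      (((2 : ℝ) ^ n + 1) * (2 ^ n + 2)) := by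
    have h1 : ∀ a b, jointProb a b * (y a * y b) = (y a * y b + y a * (comSign a b * y b) +
        2 ^ n * (if a = b then y a * y b else 0)) / (((2 : ℝ) ^ n + 1) * (2 ^ n + 2)) := by
      intro a b
      by_cases ha : a = 0
      · simp [ha, hy0]
      by_cases hb : b = 0
      · simp [hb, hy0]
      rw [jointProb_formula, if_neg ha, if_neg hb]
      split_ifs <;> ring
    simp only [h1, ← Finset.sum_div, Finset.sum_add_distrib, ← Finset.mul_sum]
    rw [sq, ← Finset.sum_mul]
    congr 3
    refine Finset.sum_congr rfl fun a _ => ?_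
    rw [sum_label_ite' a fun b => y a * y b, sq]
  have havg : ((ρ - σ) * (σ - ((2 : ℂ) ^ n)⁻¹ • (1 : Op n))).trace.re =
      circuitAvg (circuitMean (ρ - σ) (σ - ((2 : ℂ) ^ n)⁻¹ • (1 : Op n))) :=
    (circuitAvg_circuitMean hΔ (star_traceless hσ) (trace_traceless hσ1)).symm
  have htr : ((ρ - σ) * (σ - ((2 : ℂ) ^ n)⁻¹ • (1 : Op n))).trace.re = -ε := by
    rw [mul_sub, Matrix.mul_smul, mul_one, Matrix.trace_sub, Matrix.trace_smul, hΔ0, smul_zero,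
      sub_zero, sub_mul, Matrix.trace_sub, hσ2, hσ1, Matrix.trace_mul_comm, Complex.sub_re,
      Complex.one_re, hε]
    ring
  rw [havg, circuitAvg_sub_sq, ← havg, htr]
  have hsq2 : circuitAvg (fun c : CliffordModPhase n =>
      circuitMean (ρ - σ) (σ - ((2 : ℂ) ^ n)⁻¹ • (1 : Op n)) c ^ 2) =
      (((2 : ℝ) ^ n + 1) / 2 ^ n) ^ 2 * ∑ a, ∑ b, jointProb a b * (y a * y b) := by
    rw [← hsq, ← circuitAvg_mul]
    congr 1; funext c
    rw [hmean]; ring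
  rw [hsq2, hJ, hsum]
  field_simp

end Parts

/-! ### Pure states -/

section PureState

variable (φ : EuclideanSpace ℂ (Bits n))

theorem star_pureState : star (pureState φ) = pureState φ := by
  ext s t
  simp [pureState, Matrix.star_apply, mul_comm]

theorem trace_pureState (hφ : ‖φ‖ = 1) : (pureState φ).trace = 1 := by
  have h := EuclideanSpace.norm_sq_eq φ
  rw [hφ, one_pow] at h
  simp only [Matrix.trace, Matrix.diag_apply, pureState, Matrix.of_apply]
  rw [← Complex.ofReal_one, h]
  push_cast
  exact Finset.sum_congr rfl fun s _ => Complex.mul_conj' _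

/-- A pure state is a projection of rank one. -/
theorem pureState_mul_mul (A : Op n) :
    pureState φ * A * pureState φ = (A * pureState φ).trace • pureState φ := by
  ext s t
  simp only [Matrix.smul_apply, Matrix.trace, Matrix.diag_apply, Matrix.mul_apply, smul_eq_mul,
    pureState, Matrix.of_apply, Finset.sum_mul]
  rw [Finset.sum_comm]
  refine Finset.sum_congr rfl fun u _ => Finset.sum_congr rfl fun v _ => ?_
  ring

theorem pureState_mul_self (hφ : ‖φ‖ = 1) : pureState φ * pureState φ = pureState φ := by
  have h := pureState_mul_mul φ 1
  rwa [mul_one, one_mul, trace_pureState φ hφ, one_smul] at h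

theorem infidelity_eq (ρ : Op n) : infidelity φ ρ = 1 - (pureState φ * ρ).trace.re := by
  rw [infidelity]
  congr 2
  simp only [Matrix.trace, Matrix.diag_apply, Matrix.mul_apply, pureState, Matrix.of_apply]
  rw [Finset.sum_comm]
  exact Finset.sum_congr rfl fun u _ => Finset.sum_congr rfl fun v _ => by ring

theorem posSemidef_pureState (hφ : ‖φ‖ = 1) : (pureState φ).PosSemidef := by
  have h := Matrix.posSemidef_self_mul_conjTranspose (pureState φ)
  rwa [← Matrix.star_eq_conjTranspose, star_pureState, pureState_mul_self φ hφ] at h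

variable {φ}

/-- This is the squared Frobenius norm of Bσ, since σ² = σ. Suitable choices of B give the bounds on
the Pauli coefficients. -/
theorem trace_pureState_mul_sq_nonneg (hφ : ‖φ‖ = 1) {B : Op n} (hB : star B = B) :
    0 ≤ (B * B * pureState φ).trace.re := by
  have h := (Matrix.posSemidef_conjTranspose_mul_self (B * pureState φ)).trace_nonneg
  rw [← Matrix.star_eq_conjTranspose, star_mul, star_pureState, hB, mul_assoc, Matrix.trace_mul_comm,
    mul_assoc, mul_assoc, pureState_mul_self φ hφ, ← mul_assoc] at h
  exact (Complex.le_def.1 h).1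

theorem pauliCoeff_sq_le_one (hφ : ‖φ‖ = 1) (a : PauliLabel n) :
    pauliCoeff (pureState φ) a ^ 2 ≤ 1 := by
  set x := pauliCoeff (pureState φ) a with hx
  have hB : star (pauliOp a - (x : ℂ) • (1 : Op n)) = pauliOp a - (x : ℂ) • (1 : Op n) := by
    simp [star_sub, star_smul]
  have h := trace_pureState_mul_sq_nonneg hφ hB
  have h2 : ((pauliOp a - (x : ℂ) • (1 : Op n)) * (pauliOp a - (x : ℂ) • (1 : Op n)) *
      pureState φ).trace = ((1 - x ^ 2 : ℝ) : ℂ) := by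
    simp only [sub_mul, mul_sub, pauliOp_mul_self, Matrix.smul_mul, Matrix.mul_smul, one_mul,
      mul_one, Matrix.trace_sub, Matrix.trace_smul, smul_eq_mul, trace_pureState φ hφ,
      pauliCoeff_eq (star_pureState φ), ← hx]
    push_cast; ring
  rw [h2, Complex.ofReal_re] at h
  linarith

/-- An uncertainty relation for anticommuting Pauli operators. -/
theorem pauliCoeff_sq_add_sq_le (hφ : ‖φ‖ = 1) {a b : PauliLabel n} (hab : comSign a b = -1) :
    pauliCoeff (pureState φ) a ^ 2 + pauliCoeff (pureState φ) b ^ 2 ≤ 1 := by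
  set x := pauliCoeff (pureState φ) a with hx
  set y := pauliCoeff (pureState φ) b with hy
  set t := x ^ 2 + y ^ 2 with ht
  -- By anticommutation (xP_a + yP_b)² = t𝟙, and its expectation without the square is also t. So
  -- the expectation of B² is t - 2t² + t² = t - t², whence t ≤ 1.
  set B : Op n := (x : ℂ) • pauliOp a + (y : ℂ) • pauliOp b - (t : ℂ) • (1 : Op n) with hBdef
  have hB : star B = B := by
    simp [hBdef, star_sub, star_smul]
  have h := trace_pureState_mul_sq_nonneg hφ hB
  have h2 : (B * B * pureState φ).trace = ((t - t ^ 2 : ℝ) : ℂ) := by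
    simp only [hBdef, sub_mul, mul_sub, add_mul, mul_add, pauliOp_mul_self, Matrix.smul_mul,
      Matrix.mul_smul, one_mul, mul_one, Matrix.trace_sub, Matrix.trace_add, Matrix.trace_smul,
      smul_eq_mul, trace_pureState φ hφ, pauliCoeff_eq (star_pureState φ), ← hx, ← hy,
      pauliOp_mul_comm a b, hab, ht]
    push_cast; ring
  rw [h2, Complex.ofReal_re] at h
  have ht0 : 0 ≤ t := by positivity
  nlinarith

theorem sum_pauliCoeff_sq (hφ : ‖φ‖ = 1) :
    ∑ a, pauliCoeff (pureState φ) a ^ 2 = 2 ^ n := by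
  have h := sum_trace_mul_trace (pureState φ) (pureState φ)
  rw [pureState_mul_self φ hφ, trace_pureState φ hφ, mul_one] at h
  simp only [pauliCoeff_eq (star_pureState φ), ← sq] at h
  exact_mod_cast h

theorem pauliCoeff_zero (hφ : ‖φ‖ = 1) : pauliCoeff (pureState φ) 0 = 1 := by
  simp [pauliCoeff, pauliOp_zero, trace_pureState φ hφ]

theorem trace_conj_pauliOp (a : PauliLabel n) :
    (pauliOp a * pureState φ * pauliOp a * pureState φ).trace =
      ((pauliCoeff (pureState φ) a ^ 2 : ℝ) : ℂ) := by
  rw [mul_assoc (pauliOp a), mul_assoc (pauliOp a), pureState_mul_mul, Matrix.mul_smul,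
    Matrix.trace_smul, pauliCoeff_eq (star_pureState φ), smul_eq_mul]
  push_cast; ring

theorem pauliOp_mul_conj_trace (a b : PauliLabel n) (A : Op n) :
    (pauliOp a * (pauliOp b * A * pauliOp b)).trace = (comSign b a : ℂ) * (pauliOp a * A).trace := by
  have h : (pauliOp a * (pauliOp b * A * pauliOp b)).trace =
      (pauliOp b * pauliOp a * pauliOp b * A).trace := by
    simp only [← mul_assoc]
    rw [Matrix.trace_mul_comm]
    simp only [← mul_assoc]
  rw [h, pauliOp_conj, Matrix.smul_mul, Matrix.trace_smul, smul_eq_mul]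

/-- The squared Pauli coefficients of a pure state are self-dual. -/
theorem sum_comSign_mul_pauliCoeff_sq (a : PauliLabel n) :
    ∑ b, comSign a b * pauliCoeff (pureState φ) b ^ 2 =
      2 ^ n * pauliCoeff (pureState φ) a ^ 2 := by
  -- Parseval for σ and P_a σ P_a: conjugation inserts the signs on one side, and the overlap of the
  -- two pure states on the other is x_a².
  have h := sum_trace_mul_trace (pureState φ) (pauliOp a * pureState φ * pauliOp a)
  have h1 : ∀ b, (pauliOp b * (pauliOp a * pureState φ * pauliOp a)).trace =
      (comSign a b : ℂ) * pauliCoeff (pureState φ) b := by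
    intro b
    rw [pauliOp_mul_conj_trace, pauliCoeff_eq (star_pureState φ)]
  rw [Matrix.trace_mul_comm (pureState φ), trace_conj_pauliOp] at h
  simp only [h1, pauliCoeff_eq (star_pureState φ)] at h
  rw [← Complex.ofReal_inj]
  push_cast at h ⊢
  rw [← h]
  exact Finset.sum_congr rfl fun b _ => by ring

end PureState

/-! ### Noise channels -/

section PauliChannel

variable {p : PauliLabel n → ℝ}

theorem trace_pauliChannel (hp : ∑ a, p a = 1) (A : Op n) :
    (pauliChannel p A).trace = A.trace := by
  have h : ∀ a : PauliLabel n, (pauliOp a * A * pauliOp a).trace = A.trace := fun a => by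
    rw [Matrix.trace_mul_comm, ← mul_assoc, pauliOp_mul_self, one_mul]
  simp only [pauliChannel, Matrix.trace_sum, Matrix.trace_smul, h, smul_eq_mul, ← Finset.sum_mul]
  rw [← Complex.ofReal_sum, hp, Complex.ofReal_one, one_mul]

theorem posSemidef_pauliChannel (hp : ∀ a, 0 ≤ p a) {A : Op n} (hA : A.PosSemidef) :
    (pauliChannel p A).PosSemidef := by
  refine Matrix.posSemidef_sum _ fun a _ => ?_
  have h := hA.mul_mul_conjTranspose_same (pauliOp a)
  rw [← Matrix.star_eq_conjTranspose, pauliOp_star] at h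
  exact h.smul (Complex.zero_le_real.2 (hp a))

theorem pauliCoeff_pauliChannel_sub (hp : ∑ a, p a = 1) (A : Op n) (a : PauliLabel n) :
    pauliCoeff (pauliChannel p A - A) a = -(∑ b, p b * (1 - comSign b a)) * pauliCoeff A a := by
  have h1 : (pauliOp a * pauliChannel p A).trace =
      ((∑ b, p b * comSign b a : ℝ) : ℂ) * (pauliOp a * A).trace := by
    simp only [pauliChannel, Finset.mul_sum, Matrix.trace_sum, Matrix.mul_smul, Matrix.trace_smul,
      pauliOp_mul_conj_trace, smul_eq_mul]
    push_cast
    rw [Finset.sum_mul]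
    exact Finset.sum_congr rfl fun b _ => by ring
  rw [pauliCoeff, mul_sub, Matrix.trace_sub, h1, Complex.sub_re, Complex.re_ofReal_mul,
    ← pauliCoeff]
  simp only [mul_sub, mul_one, Finset.sum_sub_distrib, hp]
  ring

theorem infidelity_pauliChannel {φ : EuclideanSpace ℂ (Bits n)} (hp : ∑ a, p a = 1) :
    infidelity φ (pauliChannel p (pureState φ)) =
      ∑ b, p b * (1 - pauliCoeff (pureState φ) b ^ 2) := by
  rw [infidelity_eq, Matrix.trace_mul_comm]
  have h : (pauliChannel p (pureState φ) * pureState φ).trace =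
      ((∑ b, p b * pauliCoeff (pureState φ) b ^ 2 : ℝ) : ℂ) := by
    simp only [pauliChannel, Finset.sum_mul, Matrix.trace_sum, Matrix.smul_mul, Matrix.trace_smul,
      trace_conj_pauliOp, smul_eq_mul]
    push_cast; rfl
  rw [h, Complex.ofReal_re]
  simp only [mul_sub, mul_one, Finset.sum_sub_distrib, hp]

/-- Only the outcome part is estimated here. The circuit part is kept exact because the depolarizing
case relies on its cancellation with -ε². -/
theorem crmVariance_le_of_pauliChannel {φ : EuclideanSpace ℂ (Bits n)} (hφ : ‖φ‖ = 1) {R : ℕ}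
    (hR : 1 ≤ R) (hp0 : ∀ a, 0 ≤ p a) (hp : ∑ a, p a = 1) :
    crmVariance R (pureState φ) (fidelityObservable φ) (pauliChannel p (pureState φ)) ≤
      2 / R + (((2 : ℝ) ^ n + 1) / ((2 ^ n + 2) * (2 ^ n) ^ 2) *
        ((2 ^ n * infidelity φ (pauliChannel p (pureState φ))) ^ 2 +
      ∑ a, infidelityCoeff (pureState φ) (pauliChannel p (pureState φ)) a *
        ∑ b, comSign a b * infidelityCoeff (pureState φ) (pauliChannel p (pureState φ)) b +
      2 ^ n * ∑ a, infidelityCoeff (pureState φ) (pauliChannel p (pureState φ)) a ^ 2) -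
      infidelity φ (pauliChannel p (pureState φ)) ^ 2) := by
  have hσ := star_pureState φ
  have hσ2 := pureState_mul_self φ hφ
  have hσ1 := trace_pureState φ hφ
  have hρ := posSemidef_pauliChannel hp0 (posSemidef_pureState φ hφ)
  have hρ1 : (pauliChannel p (pureState φ)).trace = 1 := by rw [trace_pauliChannel hp, hσ1]
  rw [fidelityObservable, crmVariance_eq hR hσ (star_traceless hσ) (trace_traceless hσ1) hρ hρ1,
    circuit_variance_eq hσ hρ.1 hσ2 hσ1 hρ1, ← infidelity_eq]
  refine add_le_add ?_ le_rfl
  rw [div_eq_inv_mul]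
  exact mul_le_mul_of_nonneg_left (outcome_variance_le hσ hσ2 hσ1 hρ hρ1) (by positivity)

/-- The variance bound for Pauli noise. -/
theorem crmVariance_pauliChannel_le {φ : EuclideanSpace ℂ (Bits n)} (hφ : ‖φ‖ = 1) {R : ℕ}
    (hR : 1 ≤ R) (hp0 : ∀ a, 0 ≤ p a) (hp : ∑ a, p a = 1) :
    crmVariance R (pureState φ) (fidelityObservable φ) (pauliChannel p (pureState φ)) ≤
      2 / R + 2 * 2 * infidelity φ (pauliChannel p (pureState φ)) ^ 2 := by
  refine (crmVariance_le_of_pauliChannel hφ hR hp0 hp).trans (add_le_add le_rfl ?_)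
  set ρ := pauliChannel p (pureState φ) with hρ
  set ε := infidelity φ ρ with hε
  set y := infidelityCoeff (pureState φ) ρ with hy
  have hρs : star ρ = ρ := (posSemidef_pauliChannel hp0 (posSemidef_pureState φ hφ)).1
  have hsum : ∑ a, y a = 2 ^ n * ε := by
    rw [hy, sum_infidelityCoeff (star_pureState φ) hρs (pureState_mul_self φ hφ)
      (trace_pureState φ hφ), hε, infidelity_eq]
  have hyf : ∀ a, y a = ∑ b, p b * ((1 - comSign b a) * pauliCoeff (pureState φ) a ^ 2) := by
    intro a
    rw [hy, infidelityCoeff, hρ, pauliCoeff_pauliChannel_sub hp]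
    simp only [← mul_assoc, ← Finset.sum_mul]
    ring
  have hy0 : ∀ a, 0 ≤ y a := fun a => by
    rw [hyf]
    refine Finset.sum_nonneg fun b _ => mul_nonneg (hp0 b) (mul_nonneg ?_ (sq_nonneg _))
    linarith [comSign_le_one b a]
  -- Termwise in b: the left side is 0 if b commutes with a; otherwise it is 2x_a² ≤ 2(1 - x_b²), by
  -- the uncertainty relation.
  have hyle : ∀ a, y a ≤ 2 * ε := fun a => by
    rw [hyf, hε, hρ, infidelity_pauliChannel hp, Finset.mul_sum]
    refine Finset.sum_le_sum fun b _ => ?_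
    rw [mul_left_comm 2]
    refine mul_le_mul_of_nonneg_left ?_ (hp0 b)
    rcases comSign_eq_or b a with h | h
    · rw [h]
      linarith [pauliCoeff_sq_le_one hφ b]
    · have := pauliCoeff_sq_add_sq_le hφ h
      rw [h]; linarith
  have h1 : ∑ a, y a * ∑ b, comSign a b * y b ≤ (2 ^ n * ε) ^ 2 := by
    rw [← hsum, sq, Finset.sum_mul]
    refine Finset.sum_le_sum fun a _ => mul_le_mul_of_nonneg_left ?_ (hy0 a)
    exact Finset.sum_le_sum fun b _ => mul_le_of_le_one_left (hy0 b) (comSign_le_one a b)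
  have h2 : ∑ a, y a ^ 2 ≤ 2 * ε * (2 ^ n * ε) := by
    rw [← hsum, Finset.mul_sum]
    refine Finset.sum_le_sum fun a _ => ?_
    rw [sq]
    exact mul_le_mul_of_nonneg_right (hyle a) (hy0 a)
  have hd : (0 : ℝ) < 2 ^ n := by positivity
  -- The three terms contribute 1, 1 and 2 times (dε)².
  have h3 : (2 ^ n * ε) ^ 2 + ∑ a, y a * ∑ b, comSign a b * y b + 2 ^ n * ∑ a, y a ^ 2 ≤
      (2 ^ n) ^ 2 * (4 * ε ^ 2) := by
    have := mul_le_mul_of_nonneg_left h2 hd.le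
    nlinarith
  have h4 : ((2 : ℝ) ^ n + 1) / ((2 ^ n + 2) * (2 ^ n) ^ 2) * ((2 ^ n) ^ 2 * (4 * ε ^ 2)) ≤
      4 * ε ^ 2 := by
    have e : ((2 : ℝ) ^ n + 1) / ((2 ^ n + 2) * (2 ^ n) ^ 2) * ((2 ^ n) ^ 2 * (4 * ε ^ 2)) =
        ((2 : ℝ) ^ n + 1) / (2 ^ n + 2) * (4 * ε ^ 2) := by field_simp
    rw [e]
    refine mul_le_of_le_one_left (by positivity) ?_
    rw [div_le_one (by positivity)]; linarith
  have h5 := mul_le_mul_of_nonneg_left h3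
    (show 0 ≤ ((2 : ℝ) ^ n + 1) / ((2 ^ n + 2) * (2 ^ n) ^ 2) by positivity)
  nlinarith [sq_nonneg ε]

end PauliChannel

section Depolarizing

/-- The Pauli error probabilities of a depolarizing channel. -/
noncomputable def depolarizingProb (n : ℕ) (q : ℝ) (a : PauliLabel n) : ℝ :=
  q / (2 ^ n * 2 ^ n) + if a = 0 then 1 - q else 0

theorem depolarizingProb_nonneg {q : ℝ} (hq0 : 0 ≤ q) (hq1 : q ≤ 1) (a : PauliLabel n) :
    0 ≤ depolarizingProb n q a := by
  unfold depolarizingProb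
  have : 0 ≤ if a = 0 then 1 - q else 0 := by split_ifs <;> linarith
  positivity

theorem sum_depolarizingProb (n : ℕ) (q : ℝ) : ∑ a, depolarizingProb n q a = 1 := by
  simp only [depolarizingProb, Finset.sum_add_distrib, sum_label_const,
    sum_label_ite 0 (fun _ => 1 - q)]
  field_simp
  ring

/-- The uniform mixture of all Pauli conjugations sends a state to 𝟙/d, so the noise is that mixture
with weight q and the identity with weight 1 - q. -/
theorem depolarizing_eq_pauliChannel (q : ℝ) {σ : Op n} (hσ : σ.trace = 1) :
    depolarizing q σ = pauliChannel (depolarizingProb n q) σ := by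
  have h : ∀ a : PauliLabel n, (depolarizingProb n q a : ℂ) • (pauliOp a * σ * pauliOp a) =
      ((q / (2 ^ n * 2 ^ n) : ℝ) : ℂ) • (pauliOp a * σ * pauliOp a) +
      (if a = 0 then ((1 - q : ℝ) : ℂ) • (pauliOp a * σ * pauliOp a) else 0) := by
    intro a
    unfold depolarizingProb
    split_ifs
    · rw [← add_smul, Complex.ofReal_add]
    · simp
  simp only [pauliChannel, h, Finset.sum_add_distrib, ← Finset.smul_sum, sum_pauliOp_conj]
  rw [Finset.sum_eq_single (0 : PauliLabel n) (by simp +contextual) (by simp), if_pos rfl,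
    pauliOp_zero, one_mul, mul_one, hσ, mul_one, smul_smul, depolarizing, add_comm]
  congr 2
  push_cast
  have hd : (2 : ℂ) ^ n ≠ 0 := pow_ne_zero _ two_ne_zero
  field_simp

theorem posSemidef_depolarizing {φ : EuclideanSpace ℂ (Bits n)} (hφ : ‖φ‖ = 1) {q : ℝ}
    (hq0 : 0 ≤ q) (hq1 : q ≤ 1) : (depolarizing q (pureState φ)).PosSemidef := by
  rw [depolarizing_eq_pauliChannel q (trace_pureState φ hφ)]
  exact posSemidef_pauliChannel (depolarizingProb_nonneg hq0 hq1) (posSemidef_pureState φ hφ)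

theorem trace_depolarizing (q : ℝ) {σ : Op n} (hσ : σ.trace = 1) :
    (depolarizing q σ).trace = 1 := by
  rw [depolarizing_eq_pauliChannel q hσ, trace_pauliChannel (sum_depolarizingProb n q), hσ]

theorem two_rpow_neg_sre2 {φ : EuclideanSpace ℂ (Bits n)} (hφ : ‖φ‖ = 1) :
    (2 : ℝ) ^ (-sre2 (pureState φ)) = (∑ a, pauliCoeff (pureState φ) a ^ 4) / 2 ^ n := by
  have h : ∀ a : PauliLabel n, ‖(pureState φ * pauliOp a).trace‖ ^ 4 =
      pauliCoeff (pureState φ) a ^ 4 := by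
    intro a
    rw [Matrix.trace_mul_comm, pauliCoeff_eq (star_pureState φ), Complex.norm_real, Real.norm_eq_abs]
    exact Even.pow_abs (by decide) _
  have hpos : 0 < ∑ a, pauliCoeff (pureState φ) a ^ 4 := by
    refine Finset.sum_pos' (fun a _ => by positivity) ⟨0, Finset.mem_univ _, ?_⟩
    rw [pauliCoeff_zero hφ]; norm_num
  rw [sre2]
  simp only [h]
  rw [Real.rpow_neg (by norm_num), Real.rpow_logb (by norm_num) (by norm_num) (by positivity),
    inv_div]

/-- The variance bound for depolarizing noise. -/
theorem crmVariance_depolarizing_le {φ : EuclideanSpace ℂ (Bits n)} (hφ : ‖φ‖ = 1) {R : ℕ}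
    (hR : 1 ≤ R) {q : ℝ} (hq0 : 0 ≤ q) (hq1 : q ≤ 1) :
    crmVariance R (pureState φ) (fidelityObservable φ) (depolarizing q (pureState φ)) ≤
      2 / R + 2 * (2 : ℝ) ^ (-sre2 (pureState φ)) *
        infidelity φ (depolarizing q (pureState φ)) ^ 2 := by
  rw [two_rpow_neg_sre2 hφ]
  have hdep := depolarizing_eq_pauliChannel (n := n) q (trace_pureState φ hφ)
  have hp0 := fun a => depolarizingProb_nonneg (n := n) hq0 hq1 a
  have hbound := crmVariance_le_of_pauliChannel hφ hR hp0 (sum_depolarizingProb n q)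
  rw [← hdep] at hbound
  refine hbound.trans (add_le_add le_rfl ?_)
  have hρs : star (depolarizing q (pureState φ)) = depolarizing q (pureState φ) :=
    (posSemidef_depolarizing hφ hq0 hq1).1
  have hcoeff : ∀ a, pauliCoeff (depolarizing q (pureState φ) - pureState φ) a =
      -(q * (pauliCoeff (pureState φ) a - if a = 0 then 1 else 0)) := by
    intro a
    have hd : (2 : ℂ) ^ n ≠ 0 := pow_ne_zero _ two_ne_zero
    have h : (pauliOp a * (depolarizing q (pureState φ) - pureState φ)).trace =
        ((-(q * (pauliCoeff (pureState φ) a - if a = 0 then 1 else 0)) : ℝ) : ℂ) := by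
      rw [depolarizing, mul_sub, mul_add, Matrix.mul_smul, Matrix.mul_smul, mul_one,
        Matrix.trace_sub, Matrix.trace_add, Matrix.trace_smul, Matrix.trace_smul, trace_pauliOp,
        pauliCoeff_eq (star_pureState φ), smul_eq_mul, smul_eq_mul]
      split_ifs
      · push_cast; field_simp; ring
      · push_cast; ring
    rw [pauliCoeff, h, Complex.ofReal_re]
  set ρ := depolarizing q (pureState φ) with hρ
  set ε := infidelity φ ρ with hε
  set x := pauliCoeff (pureState φ) with hx
  have hx0 : x 0 = 1 := pauliCoeff_zero hφ
  have hy : ∀ a, infidelityCoeff (pureState φ) ρ a = q * (x a ^ 2 - if a = 0 then 1 else 0) := by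
    intro a
    rw [infidelityCoeff, hcoeff]
    split_ifs with h
    · subst h; rw [← hx, hx0]; ring
    · rw [← hx]; ring
  have hx2 : ∑ a, x a ^ 2 = 2 ^ n := sum_pauliCoeff_sq hφ
  have hsum := sum_infidelityCoeff (star_pureState φ) hρs (pureState_mul_self φ hφ)
    (trace_pureState φ hφ)
  rw [← infidelity_eq, ← hε] at hsum
  simp only [hy, ← Finset.mul_sum, Finset.sum_sub_distrib, sum_label_ite 0 (fun _ => (1 : ℝ)),
    hx2] at hsum
  set S := ∑ a, x a ^ 4 with hS
  -- Self-duality of the squared coefficients makes the quadratic form in the signs collapse to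
  -- fourth powers.
  have hχ : ∀ a, ∑ b, comSign a b * (x b ^ 2 - if b = 0 then 1 else 0) = 2 ^ n * x a ^ 2 - 1 := by
    intro a
    simp only [mul_sub, Finset.sum_sub_distrib, mul_ite, mul_one, mul_zero]
    rw [sum_comSign_mul_pauliCoeff_sq, sum_label_ite 0 (comSign a), comSign_zero_right]
  have h1 : ∑ a, infidelityCoeff (pureState φ) ρ a *
      ∑ b, comSign a b * infidelityCoeff (pureState φ) ρ b =
      q ^ 2 * (2 ^ n * S - 2 * 2 ^ n + 1) := by
    have : ∀ a, infidelityCoeff (pureState φ) ρ a *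
        ∑ b, comSign a b * infidelityCoeff (pureState φ) ρ b =
        q ^ 2 * (2 ^ n * x a ^ 4 - x a ^ 2 - if a = 0 then 2 ^ n - 1 else 0) := by
      intro a
      have e : ∑ b, comSign a b * infidelityCoeff (pureState φ) ρ b =
          q * (2 ^ n * x a ^ 2 - 1) := by
        rw [← hχ, Finset.mul_sum]
        exact Finset.sum_congr rfl fun b _ => by rw [hy]; ring
      rw [e, hy]
      split_ifs with h
      · subst h; rw [hx0]; ring
      · ring
    simp only [this, ← Finset.mul_sum, Finset.sum_sub_distrib,
      sum_label_ite 0 (fun _ => (2 : ℝ) ^ n - 1), hx2, ← hS]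
    ring
  have h2 : ∑ a, infidelityCoeff (pureState φ) ρ a ^ 2 = q ^ 2 * (S - 1) := by
    have : ∀ a, infidelityCoeff (pureState φ) ρ a ^ 2 =
        q ^ 2 * (x a ^ 4 - if a = 0 then 1 else 0) := by
      intro a
      rw [hy]
      split_ifs with h
      · subst h; rw [hx0]; ring
      · ring
    simp only [this, ← Finset.mul_sum, Finset.sum_sub_distrib, sum_label_ite 0 (fun _ => (1 : ℝ)),
      ← hS]
  have hSle : S ≤ 2 ^ n := by
    rw [← hx2]
    refine Finset.sum_le_sum fun a _ => ?_
    have := pauliCoeff_sq_le_one hφ a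
    rw [← hx] at this
    nlinarith [sq_nonneg (x a)]
  rw [h1, h2, ← hsum]
  have hεq : ε = q * (2 ^ n - 1) / 2 ^ n := by rw [hsum]; field_simp
  rw [hεq]
  have hd : (0 : ℝ) < 2 ^ n := by positivity
  -- No power of two lies strictly between 1 and 2. The product is d² - 3d + 2, the slack between
  -- 2d² and d² + 3d - 2.
  have hd12 : 0 ≤ ((2 : ℝ) ^ n - 1) * (2 ^ n - 2) := by
    rcases Nat.eq_zero_or_pos n with h | h
    · subst h; norm_num
    · have : (2 : ℝ) ≤ 2 ^ n := le_self_pow₀ (by norm_num) (by omega)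
      exact mul_nonneg (by linarith) (by linarith)
  set d : ℝ := 2 ^ n
  have hkey : S * (d ^ 2 + 3 * d - 2) ≤ 2 * d ^ 3 := by
    have h3 : S * (2 * d ^ 2) ≤ d * (2 * d ^ 2) := mul_le_mul_of_nonneg_right hSle (by positivity)
    have hS0 : 0 ≤ S := Finset.sum_nonneg fun a _ => by positivity
    nlinarith [mul_nonneg hS0 hd12]
  have hdiff : 2 * (S / d) * (q * (d - 1) / d) ^ 2 -
      ((d + 1) / ((d + 2) * d ^ 2) * ((q * (d - 1)) ^ 2 + q ^ 2 * (d * S - 2 * d + 1) +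
        d * (q ^ 2 * (S - 1))) - (q * (d - 1) / d) ^ 2) =
      2 * q ^ 2 / (d ^ 3 * (d + 2)) * (2 * d ^ 3 - S * (d ^ 2 + 3 * d - 2)) := by
    field_simp
    ring
  have hnn : 0 ≤ 2 * q ^ 2 / (d ^ 3 * (d + 2)) * (2 * d ^ 3 - S * (d ^ 2 + 3 * d - 2)) :=
    mul_nonneg (by positivity) (by linarith)
  linarith

end Depolarizing

/-! ### The median -/

/-- The upper middle element of the sorted list is at least the median, so it and all later elements
exceed t. There are ℓ - ⌊ℓ/2⌋ ≥ ℓ/2 of them for length ℓ. -/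
theorem countP_of_lt_median {l : List ℝ} (hl : 1 ≤ l.length) {t : ℝ} (ht : t < median l) :
    l.length ≤ 2 * l.countP (fun x => t < x) := by
  set m := l.insertionSort (· ≤ ·) with hm
  have hlen : m.length = l.length := List.length_insertionSort ..
  have hs : m.Pairwise (· ≤ ·) := List.pairwise_insertionSort ..
  have hmono : ∀ i j (_ : i ≤ j) (hj : j < m.length), m[i] ≤ m[j] := by
    intro i j hij hj
    rcases hij.eq_or_lt with rfl | h
    · exact le_rfl
    · exact List.pairwise_iff_getElem.1 hs i j (by omega) hj h
  -- Both middle indices are in range for a nonempty list, so the default value 0 in `median` is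
  -- never used.
  have hi : (l.length - 1) / 2 < m.length := by omega
  have hj : l.length / 2 < m.length := by omega
  have hmed : median l = (m[(l.length - 1) / 2] + m[l.length / 2]) / 2 := by
    simp only [median, ← hm, List.getD_eq_getElem _ _ hi, List.getD_eq_getElem _ _ hj]
  have h1 : t < m[l.length / 2] := by
    have := hmono ((l.length - 1) / 2) (l.length / 2) (by omega) hj
    linarith
  have h2 : (m.drop (l.length / 2)).countP (fun x => t < x) = (m.drop (l.length / 2)).length := by
    rw [List.countP_eq_length]
    intro x hx
    obtain ⟨k, hk, rfl⟩ := List.mem_iff_getElem.1 hx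
    rw [List.getElem_drop]
    rw [List.length_drop] at hk
    exact decide_eq_true (h1.trans_le (hmono _ _ (by omega) (by omega)))
  have h3 := (List.drop_sublist (l.length / 2) m).countP_le (p := fun x => decide (t < x))
  rw [h2, List.length_drop, (List.perm_insertionSort (· ≤ ·) l).countP_eq] at h3
  omega

theorem countP_of_median_lt {l : List ℝ} (hl : 1 ≤ l.length) {t : ℝ} (ht : median l < t) :
    l.length ≤ 2 * l.countP (fun x => x < t) := by
  set m := l.insertionSort (· ≤ ·) with hm
  have hlen : m.length = l.length := List.length_insertionSort ..
  have hs : m.Pairwise (· ≤ ·) := List.pairwise_insertionSort ..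
  have hmono : ∀ i j (_ : i ≤ j) (hj : j < m.length), m[i] ≤ m[j] := by
    intro i j hij hj
    rcases hij.eq_or_lt with rfl | h
    · exact le_rfl
    · exact List.pairwise_iff_getElem.1 hs i j (by omega) hj h
  have hi : (l.length - 1) / 2 < m.length := by omega
  have hj : l.length / 2 < m.length := by omega
  have hmed : median l = (m[(l.length - 1) / 2] + m[l.length / 2]) / 2 := by
    simp only [median, ← hm, List.getD_eq_getElem _ _ hi, List.getD_eq_getElem _ _ hj]
  have h1 : m[(l.length - 1) / 2] < t := by
    have := hmono ((l.length - 1) / 2) (l.length / 2) (by omega) hj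
    linarith
  have h2 : (m.take ((l.length - 1) / 2 + 1)).countP (fun x => x < t) =
      (m.take ((l.length - 1) / 2 + 1)).length := by
    rw [List.countP_eq_length]
    intro x hx
    obtain ⟨k, hk, rfl⟩ := List.mem_iff_getElem.1 hx
    rw [List.getElem_take]
    rw [List.length_take] at hk
    exact decide_eq_true ((hmono k _ (by omega) hi).trans_lt h1)
  have h3 := (List.take_sublist ((l.length - 1) / 2 + 1) m).countP_le
    (p := fun x => decide (x < t))
  rw [h2, List.length_take, (List.perm_insertionSort (· ≤ ·) l).countP_eq] at h3
  omega

theorem countP_ofFn {K : ℕ} (g : Fin K → ℝ) (p : ℝ → Prop) [DecidablePred p] :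
    (List.ofFn g).countP (fun x => p x) = (Finset.univ.filter fun j => p (g j)).card := by
  rw [← Multiset.coe_countP, List.ofFn_eq_map, ← Multiset.map_coe, Multiset.countP_map]
  rfl

/-- If the median is off by more than `err`, so is at least half of the list. -/
theorem card_of_median_far {K : ℕ} (hK : 1 ≤ K) (g : Fin K → ℝ) {μ err : ℝ}
    (h : err < |median (List.ofFn g) - μ|) :
    K ≤ 2 * (Finset.univ.filter fun j => err < |g j - μ|).card := by
  rcases lt_abs.1 h with h | h
  · have h1 := countP_of_lt_median (l := List.ofFn g) (by simpa using hK)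
      (show μ + err < _ by linarith)
    rw [countP_ofFn g (fun x => μ + err < x), List.length_ofFn] at h1
    refine h1.trans (Nat.mul_le_mul_left 2 (Finset.card_le_card fun j hj => ?_))
    simp only [Finset.mem_filter, Finset.mem_univ, true_and] at hj ⊢
    exact lt_abs.2 (Or.inl (by linarith))
  · have h1 := countP_of_median_lt (l := List.ofFn g) (by simpa using hK)
      (show _ < μ - err by linarith)
    rw [countP_ofFn g (fun x => x < μ - err), List.length_ofFn] at h1
    refine h1.trans (Nat.mul_le_mul_left 2 (Finset.card_le_card fun j hj => ?_))
    simp only [Finset.mem_filter, Finset.mem_univ, true_and] at hj ⊢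
    exact lt_abs.2 (Or.inr (by linarith))

/-! ### Concentration of the median of means -/

section Concentration

variable {Ω : Type*} [Finite Ω] [MeasurableSpace Ω] [DiscreteMeasurableSpace Ω] {N : ℕ}
  (ν : Measure Ω) [IsProbabilityMeasure ν]

/-- Events that depend on disjoint blocks of coordinates are independent: such an event is the
preimage of its own image under restriction to its block, and the restrictions are independent. -/
theorem pi_inter_of_disjoint {S T : Finset (Fin N)} (hST : Disjoint S T) {A B : Set (Fin N → Ω)}
    (hA : ∀ ω ω', (∀ i ∈ S, ω i = ω' i) → ω ∈ A → ω' ∈ A)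
    (hB : ∀ ω ω', (∀ i ∈ T, ω i = ω' i) → ω ∈ B → ω' ∈ B) :
    Measure.pi (fun _ => ν) (A ∩ B) = Measure.pi (fun _ => ν) A * Measure.pi (fun _ => ν) B := by
  have hind : ProbabilityTheory.iIndepFun (fun (i : Fin N) (ω : Fin N → Ω) => ω i)
      (Measure.pi fun _ => ν) :=
    ProbabilityTheory.iIndepFun_pi (X := fun _ x => x) fun _ => aemeasurable_id
  have h := hind.indepFun_finset S T hST fun i => measurable_pi_apply i
  have key : ∀ (U : Finset (Fin N)) (C : Set (Fin N → Ω)),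
      (∀ ω ω', (∀ i ∈ U, ω i = ω' i) → ω ∈ C → ω' ∈ C) →
      (fun (ω : Fin N → Ω) (i : U) => ω i) ⁻¹' ((fun (ω : Fin N → Ω) (i : U) => ω i) '' C) = C := by
    intro U C hC
    refine Set.Subset.antisymm ?_ (Set.subset_preimage_image _ _)
    rintro ω ⟨ω', hω', he⟩
    exact hC ω' ω (fun i hi => congrFun he ⟨i, hi⟩) hω'
  have := h.measure_inter_preimage_eq_mul ((fun (ω : Fin N → Ω) (i : S) => ω i) '' A)
    ((fun (ω : Fin N → Ω) (i : T) => ω i) '' B) (.of_discrete) (.of_discrete)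
  rwa [key S A hA, key T B hB] at this

/-- Chebyshev's inequality for the empirical mean over a group. -/
theorem group_mean_far_le (f : Ω → ℝ) (G : Finset (Fin N)) {m : ℕ} (hG : G.card = m) (hm : 0 < m)
    {err : ℝ} (herr : 0 < err) :
    Measure.pi (fun _ => ν) {ω : Fin N → Ω | err < |(∑ i ∈ G, f (ω i)) / m - ∫ x, f x ∂ν|} ≤
      ENNReal.ofReal (ProbabilityTheory.variance f ν / (m * err ^ 2)) := by
  have hm0 : (m : ℝ) ≠ 0 := by positivity
  set P : Measure (Fin N → Ω) := Measure.pi fun _ => ν with hP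
  have hpres : ∀ i : Fin N, MeasurePreserving (Function.eval i) P ν := fun i =>
    measurePreserving_eval (fun _ => ν) i
  set Y : (Fin N → Ω) → ℝ := fun ω => (m : ℝ)⁻¹ * (∑ i ∈ G, fun ω : Fin N → Ω => f (ω i)) ω with hY
  have hmean : ∫ ω, Y ω ∂P = ∫ x, f x ∂ν := by
    have h1 : ∀ i : Fin N, ∫ ω : Fin N → Ω, f (ω i) ∂P = ∫ x, f x ∂ν := by
      intro i
      rw [← (hpres i).map_eq, integral_map (hpres i).aemeasurable
        Measurable.of_discrete.aestronglyMeasurable]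
    simp only [hY, Finset.sum_apply]
    rw [integral_const_mul, integral_finsetSum _ fun i _ => .of_finite]
    simp only [h1, Finset.sum_const, hG, nsmul_eq_mul]
    field_simp
  have hvar : ProbabilityTheory.variance Y P = ProbabilityTheory.variance f ν / m := by
    have h1 : ∀ i : Fin N, ProbabilityTheory.variance (fun ω : Fin N → Ω => f (ω i)) P =
        ProbabilityTheory.variance f ν := fun i =>
      (hpres i).variance_fun_comp Measurable.of_discrete.aemeasurable
    rw [hY, ProbabilityTheory.variance_const_mul, ProbabilityTheory.IndepFun.variance_sum]
    · simp only [h1, Finset.sum_const, hG, nsmul_eq_mul]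
      field_simp
    · exact fun i _ => .of_discrete
    · intro i _ j _ hij
      exact (ProbabilityTheory.iIndepFun_pi (X := fun _ => f) (μ := fun _ => ν)
        fun _ => Measurable.of_discrete.aemeasurable).indepFun hij
  have hch := ProbabilityTheory.meas_ge_le_variance_div_sq (μ := P) (X := Y) .of_discrete herr
  rw [hmean, hvar, div_div] at hch
  refine (measure_mono fun ω hω => ?_).trans hch
  have hω' : err < |(∑ i ∈ G, f (ω i)) / m - ∫ x, f x ∂ν| := hω
  have e : Y ω = (∑ i ∈ G, f (ω i)) / m := by
    simp only [hY, Finset.sum_apply]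
    rw [div_eq_inv_mul]
  change err ≤ |Y ω - ∫ x, f x ∂ν|
  rw [e]; exact hω'.le

/-- The indices of the group `j`. -/
def groupIndices (N K : ℕ) (j : ℕ) : Finset (Fin N) :=
  Finset.univ.filter fun i : Fin N => (i : ℕ) / (N / K) = j

/-- The group is the block from j⌊N/K⌋ to (j+1)⌊N/K⌋ - 1, which fits below N because j < K. The
remaining N mod K rounds belong to none of these groups. -/
theorem card_groupIndices {N K : ℕ} (hm : 0 < N / K) (j : Fin K) :
    (groupIndices N K j).card = N / K := by
  set m := N / K with hmdef
  have hlt : ∀ x, x < m → j * m + x < N := by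
    intro x hx
    have h1 : (j + 1) * m ≤ K * m := Nat.mul_le_mul_right m j.2
    have h2 : K * m ≤ N := Nat.mul_div_le N K
    nlinarith
  have h : groupIndices N K j =
      (Finset.univ : Finset (Fin m)).image fun x : Fin m => (⟨j * m + x, hlt x x.2⟩ : Fin N) := by
    ext i
    simp only [groupIndices, ← hmdef, Finset.mem_filter, Finset.mem_univ, true_and,
      Finset.mem_image]
    constructor
    · intro h
      refine ⟨⟨i % m, Nat.mod_lt _ hm⟩, Fin.ext ?_⟩
      change j * m + i % m = (i : ℕ)
      rw [← h, mul_comm]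
      exact Nat.div_add_mod i m
    · rintro ⟨x, rfl⟩
      change (j * m + x) / m = (j : ℕ)
      rw [mul_comm, Nat.mul_add_div hm, Nat.div_eq_of_lt x.2, add_zero]
  rw [h, Finset.card_image_of_injective, Finset.card_univ, Fintype.card_fin]
  intro x y hxy
  have : j * m + (x : ℕ) = j * m + y := congrArg Fin.val hxy
  exact Fin.ext (by omega)

/-- The probability that the median of means is off by more than `err`. -/
theorem medianOfMeans_far_le (f : Ω → ℝ) {K : ℕ} (hK : 1 ≤ K) (hKN : K ≤ N) {err p : ℝ}
    (herr : 0 < err) (hp1 : p ≤ 1)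
    (hp : ProbabilityTheory.variance f ν / ((N / K : ℕ) * err ^ 2) ≤ p) :
    Measure.pi (fun _ => ν)
      {ω : Fin N → Ω | err < |medianOfMeans K (fun i => f (ω i)) - ∫ x, f x ∂ν|} ≤
      ENNReal.ofReal ((2 * √p) ^ K) := by
  have hm : 0 < N / K := Nat.div_pos hKN hK
  set m := N / K with hmdef
  set P : Measure (Fin N → Ω) := Measure.pi fun _ => ν with hP
  have hp0 : 0 ≤ p := (div_nonneg (ProbabilityTheory.variance_nonneg _ _) (by positivity)).trans hp
  set bad : Fin K → Set (Fin N → Ω) := fun j =>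
    {ω | err < |(∑ i ∈ groupIndices N K j, f (ω i)) / m - ∫ x, f x ∂ν|} with hbad
  have hbadp : ∀ j, P (bad j) ≤ ENNReal.ofReal p := fun j =>
    (group_mean_far_le ν f _ (card_groupIndices hm j) hm herr).trans (ENNReal.ofReal_le_ofReal hp)
  have hbaddep : ∀ (j : Fin K) (ω ω' : Fin N → Ω), (∀ i ∈ groupIndices N K j, ω i = ω' i) →
      ω ∈ bad j → ω' ∈ bad j := by
    intro j ω ω' h hω
    have e : ∑ i ∈ groupIndices N K j, f (ω i) = ∑ i ∈ groupIndices N K j, f (ω' i) :=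
      Finset.sum_congr rfl fun i hi => by rw [h i hi]
    simp only [hbad, Set.mem_ofPred_eq] at hω ⊢
    rwa [← e]
  -- The groups are disjoint, so adding one more bad group costs another factor p.
  have hinter : ∀ S : Finset (Fin K), P (⋂ j ∈ S, bad j) ≤ ENNReal.ofReal p ^ S.card := by
    intro S
    induction S using Finset.induction_on with
    | empty => simp
    | insert j S hj ih =>
      rw [Finset.set_biInter_insert, Finset.card_insert_of_notMem hj, pow_succ']
      have hdisj : Disjoint (groupIndices N K j) (S.biUnion fun k => groupIndices N K k) := by
        rw [Finset.disjoint_biUnion_right]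
        intro k hk
        rw [Finset.disjoint_left]
        intro i hi hi'
        simp only [groupIndices, Finset.mem_filter, Finset.mem_univ, true_and] at hi hi'
        exact hj (by rwa [Fin.ext (hi.symm.trans hi')])
      rw [hP, pi_inter_of_disjoint ν hdisj (hbaddep j) ?_]
      · exact mul_le_mul' (hbadp j) ih
      · intro ω ω' h hω
        simp only [Set.mem_iInter] at hω ⊢
        intro k hk
        exact hbaddep k ω ω' (fun i hi => h i (Finset.mem_biUnion.2 ⟨k, hk, hi⟩)) (hω k hk)
  have hsub : {ω : Fin N → Ω | err < |medianOfMeans K (fun i => f (ω i)) - ∫ x, f x ∂ν|} ⊆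
      ⋃ S ∈ Finset.univ.filter (fun S : Finset (Fin K) => K ≤ 2 * S.card), ⋂ j ∈ S, bad j := by
    intro ω hω
    have hω' : err < |medianOfMeans K (fun i => f (ω i)) - ∫ x, f x ∂ν| := hω
    have h1 := card_of_median_far hK _ hω'
    refine Set.mem_biUnion (Finset.mem_coe.2 (Finset.mem_filter.2 ⟨Finset.mem_univ _, h1⟩)) ?_
    simp only [Set.mem_iInter]
    intro j hj
    have h2 := (Finset.mem_filter.1 hj).2
    simp only [hbad, Set.mem_ofPred_eq, groupIndices, Finset.sum_filter]
    exact h2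
  -- At least K/2 groups are bad and p ≤ 1, hence p^|S| = (√p)^(2|S|) ≤ (√p)^K. The number 2^K of
  -- sets then enters as the factor 2 of the base.
  have hpow : ∀ S : Finset (Fin K), K ≤ 2 * S.card →
      ENNReal.ofReal p ^ S.card ≤ ENNReal.ofReal (√p ^ K) := by
    intro S hS
    rw [← ENNReal.ofReal_pow hp0]
    refine ENNReal.ofReal_le_ofReal ?_
    calc p ^ S.card = √p ^ (2 * S.card) := by rw [pow_mul, Real.sq_sqrt hp0]
      _ ≤ √p ^ K := pow_le_pow_of_le_one (Real.sqrt_nonneg _) (Real.sqrt_le_one.2 hp1) hS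
  calc _ ≤ P (⋃ S ∈ Finset.univ.filter (fun S : Finset (Fin K) => K ≤ 2 * S.card),
        ⋂ j ∈ S, bad j) := measure_mono hsub
    _ ≤ ∑ S ∈ Finset.univ.filter (fun S : Finset (Fin K) => K ≤ 2 * S.card),
        P (⋂ j ∈ S, bad j) := measure_biUnion_finset_le _ _
    _ ≤ ∑ S ∈ Finset.univ.filter (fun S : Finset (Fin K) => K ≤ 2 * S.card),
        ENNReal.ofReal (√p ^ K) :=
      Finset.sum_le_sum fun S hS => (hinter S).trans (hpow S (Finset.mem_filter.1 hS).2)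
    _ ≤ ∑ S : Finset (Fin K), ENNReal.ofReal (√p ^ K) :=
      Finset.sum_le_sum_of_subset (Finset.filter_subset _ _)
    _ = ENNReal.ofReal ((2 * √p) ^ K) := by
      rw [Finset.sum_const, Finset.card_univ, Fintype.card_finset, Fintype.card_fin, nsmul_eq_mul,
        mul_pow, ENNReal.ofReal_mul (by positivity), ENNReal.ofReal_pow (by norm_num)]
      simp

theorem medianOfMeans_one (x : Fin N → ℝ) : medianOfMeans 1 x = (∑ i, x i) / N := by
  have h : ∀ i : Fin N, (i : ℕ) / N = 0 := fun i => Nat.div_eq_of_lt i.2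
  simp [medianOfMeans, median, h]

/-- The probability that the empirical mean is off by more than `err`. -/
theorem empiricalMean_far_le (f : Ω → ℝ) (hN : 0 < N) {err : ℝ} (herr : 0 < err) :
    Measure.pi (fun _ => ν)
      {ω : Fin N → Ω | err < |medianOfMeans 1 (fun i => f (ω i)) - ∫ x, f x ∂ν|} ≤
      ENNReal.ofReal (ProbabilityTheory.variance f ν / (N * err ^ 2)) := by
  simp only [medianOfMeans_one]
  exact group_mean_far_le ν f Finset.univ (by simp) hN herr

end Concentration

/-! ### Sample costs -/

section Cost

variable {R : ℕ} {σ O ρ : Op n} {err δ : ℝ}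

theorem circuitCost_le {K B : ℕ} (h : ∀ N, B ≤ N → Succeeds R σ O ρ err δ K N) :
    circuitCost R σ O ρ err δ K ≤ (B : ℕ∞) :=
  iInf₂_le B h

theorem succeeds_of_far_le (hR : 1 ≤ R) (hσ : star σ = σ) (hO : star O = O) (hO0 : O.trace = 0)
    (hρ : ρ.PosSemidef) (hρ1 : ρ.trace = 1) {K N : ℕ} (hKN : K ≤ N) (hδ : 0 ≤ δ)
    (h : Measure.pi (fun _ : Fin N => roundLaw R ρ)
      {ω | err < |medianOfMeans K (fun i => crmEstimator σ O (ω i)) -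
        ∫ x, crmEstimator σ O x ∂(roundLaw R ρ)|} ≤ ENNReal.ofReal δ) :
    Succeeds R σ O ρ err δ K N := by
  have := isProbabilityMeasure_roundLaw (R := R) hρ hρ1
  rw [integral_crmEstimator hR hσ hO hO0 hρ hρ1] at h
  refine ⟨hKN, ?_⟩
  have h1 := ENNReal.toReal_mono ENNReal.ofReal_ne_top h
  rw [ENNReal.toReal_ofReal hδ] at h1
  have h2 := probReal_add_probReal_compl (μ := Measure.pi fun _ : Fin N => roundLaw R ρ)
    (s := {ω | err < |medianOfMeans K (fun i => crmEstimator σ O (ω i)) - (O * ρ).trace.re|})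
    (.of_discrete)
  have h3 : {ω : Fin N → Round n R |
      |medianOfMeans K (fun i => crmEstimator σ O (ω i)) - (O * ρ).trace.re| ≤ err} =
      {ω | err < |medianOfMeans K (fun i => crmEstimator σ O (ω i)) - (O * ρ).trace.re|}ᶜ := by
    ext ω
    simp only [Set.mem_ofPred_eq, Set.mem_compl_iff, not_lt]
  rw [h3]
  change Measure.real _ _ ≤ δ at h1
  linarith

theorem two_thirds_lt_log {δ : ℝ} (hδ0 : 0 < δ) (hδ1 : δ < 1) : 2 / 3 < Real.log (2 / δ) := by
  have h : Real.log 2 ≤ Real.log (2 / δ) :=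
    Real.log_le_log (by norm_num) (by rw [le_div_iff₀ hδ0]; linarith)
  have := Real.log_two_gt_d9
  linarith

theorem one_le_numGroups (hδ0 : 0 < δ) (hδ1 : δ < 1) : 1 ≤ numGroups δ := by
  have := two_thirds_lt_log hδ0 hδ1
  exact Nat.one_le_ceil_iff.2 (by linarith)

/-- For L ≥ 1, rounding up gives less than 2L + 1 ≤ 3L. For L < 1 it gives at most 2, which is below
3L because L ≥ ln 2 > 2/3. -/
theorem numGroups_le (hδ0 : 0 < δ) (hδ1 : δ < 1) :
    (numGroups δ : ℝ) ≤ 3 * Real.log (2 / δ) := by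
  have hL := two_thirds_lt_log hδ0 hδ1
  rcases le_or_gt 1 (Real.log (2 / δ)) with h | h
  · have := Nat.ceil_lt_add_one (show 0 ≤ 2 * Real.log (2 / δ) by linarith)
    rw [numGroups]; linarith
  · have h2 : numGroups δ ≤ 2 := Nat.ceil_le.2 (by push_cast; linarith)
    have h3 : (numGroups δ : ℝ) ≤ 2 := by exact_mod_cast h2
    linarith

/-- The number of rounds after which the median of means succeeds. -/
theorem succeeds_numGroups (hR : 1 ≤ R) (hσ : star σ = σ) (hO : star O = O) (hO0 : O.trace = 0)
    (hρ : ρ.PosSemidef) (hρ1 : ρ.trace = 1) (herr : 0 < err) (hδ0 : 0 < δ) (hδ1 : δ < 1) {N : ℕ}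
    (hKN : numGroups δ ≤ N)
    (hN : 68 * crmVariance R σ O ρ / err ^ 2 * Real.log (2 / δ) ≤ N) :
    Succeeds R σ O ρ err δ (numGroups δ) N := by
  have := isProbabilityMeasure_roundLaw (R := R) hρ hρ1
  refine succeeds_of_far_le hR hσ hO hO0 hρ hρ1 hKN hδ0.le ?_
  have hK1 := one_le_numGroups hδ0 hδ1
  have hK3 := numGroups_le hδ0 hδ1
  have hKlog : 2 * Real.log (2 / δ) ≤ numGroups δ := Nat.le_ceil _
  set K := numGroups δ
  set L := Real.log (2 / δ) with hL
  have hLpos : 2 / 3 < L := two_thirds_lt_log hδ0 hδ1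
  have hm : 0 < N / K := Nat.div_pos hKN hK1
  -- Discarding the incomplete group loses at most half of the rounds: N < K(m+1) with m ≥ 1.
  have hNlt : N < 2 * (K * (N / K)) := by
    have h1 := Nat.lt_mul_div_succ N hK1
    have h2 : K * 1 ≤ K * (N / K) := Nat.mul_le_mul_left K hm
    rw [mul_add] at h1
    omega
  set m := N / K
  have hNlt' : (N : ℝ) < 2 * (K * m) := by exact_mod_cast hNlt
  have hm' : (0 : ℝ) < m := by exact_mod_cast hm
  set v := crmVariance R σ O ρ with hv
  have herr2 : 0 < err ^ 2 := by positivity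
  set w := v / err ^ 2 with hw
  have hNw : 68 * w * L ≤ N := by rw [hw, ← mul_div_assoc]; exact hN
  -- From 68wL ≤ N < 2Km ≤ 6Lm. So Chebyshev bounds the failure probability of a group by w/m ≤
  -- 3/34.
  have hmw : 34 * w ≤ 3 * m := by
    have h1 : (K : ℝ) * m ≤ 3 * L * m := mul_le_mul_of_nonneg_right hK3 hm'.le
    have h2 : (34 * w) * L ≤ (3 * m) * L := by linarith
    exact le_of_mul_le_mul_right h2 (by linarith)
  refine (medianOfMeans_far_le (roundLaw R ρ) (crmEstimator σ O) hK1 hKN herr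
    (p := 3 / 34) (by norm_num) ?_).trans ?_
  · change v / (m * err ^ 2) ≤ 3 / 34
    rw [mul_comm (m : ℝ), ← div_div, ← hw, div_le_iff₀ hm']
    linarith
  · refine ENNReal.ofReal_le_ofReal ?_
    -- After squaring this is 6/17 ≤ 1/e, which is what makes the constant 68 large enough.
    have he : 2 * √(3 / 34) ≤ Real.exp (-(1 / 2)) := by
      refine (pow_le_pow_iff_left₀ (by positivity) (Real.exp_pos _).le two_ne_zero).1 ?_
      rw [mul_pow, Real.sq_sqrt (by norm_num), ← Real.exp_nat_mul]
      have : Real.exp (((2 : ℕ) : ℝ) * -(1 / 2)) = (Real.exp 1)⁻¹ := by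
        rw [← Real.exp_neg]; norm_num
      rw [this, ← one_div, le_div_iff₀ (Real.exp_pos 1)]
      have := Real.exp_one_lt_d9
      linarith
    calc (2 * √(3 / 34)) ^ K ≤ Real.exp (-(1 / 2)) ^ K :=
          pow_le_pow_left₀ (by positivity) he K
      _ = Real.exp (-(K / 2)) := by rw [← Real.exp_nat_mul]; ring_nf
      _ ≤ Real.exp (-L) := Real.exp_le_exp.2 (by linarith)
      _ = δ / 2 := by
        rw [Real.exp_neg, hL, Real.exp_log (by positivity), inv_div]
      _ ≤ δ := by linarith

/-- The number of rounds after which the empirical mean succeeds. -/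
theorem succeeds_one (hR : 1 ≤ R) (hσ : star σ = σ) (hO : star O = O) (hO0 : O.trace = 0)
    (hρ : ρ.PosSemidef) (hρ1 : ρ.trace = 1) (herr : 0 < err) (hδ0 : 0 < δ) (hδ1 : δ < 1) {N : ℕ}
    (hN1 : 1 ≤ N) (hN : 68 * crmVariance R σ O ρ / err ^ 2 * Real.log (2 / δ) ≤ N)
    (hδ : 1 ≤ 68 * δ * Real.log (2 / δ)) :
    Succeeds R σ O ρ err δ 1 N := by
  have := isProbabilityMeasure_roundLaw (R := R) hρ hρ1
  refine succeeds_of_far_le hR hσ hO hO0 hρ hρ1 hN1 hδ0.le ?_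
  refine (empiricalMean_far_le (roundLaw R ρ) (crmEstimator σ O) hN1 herr).trans
    (ENNReal.ofReal_le_ofReal ?_)
  change crmVariance R σ O ρ / (N * err ^ 2) ≤ δ
  have hLpos : 2 / 3 < Real.log (2 / δ) := two_thirds_lt_log hδ0 hδ1
  have hN' : (0 : ℝ) < N := by exact_mod_cast hN1
  have hv : 0 ≤ crmVariance R σ O ρ := ProbabilityTheory.variance_nonneg _ _
  set w := crmVariance R σ O ρ / err ^ 2 with hw
  have hw0 : 0 ≤ w := by positivity
  have hNw : 68 * w * Real.log (2 / δ) ≤ N := by rw [hw, ← mul_div_assoc]; exact hN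
  rw [mul_comm (N : ℝ), ← div_div, ← hw, div_le_iff₀ hN']
  -- The chain is w ≤ 68δLw ≤ δN.
  nlinarith [mul_le_mul_of_nonneg_left hNw hδ0.le, mul_le_mul_of_nonneg_left hδ hw0]

end Cost

/-- A variance bound of the form `2 / R + 2 M ε ^ 2` yields the sample costs. -/
theorem hpfeCost_bounds {R : ℕ} (hR : 1 ≤ R) {φ : EuclideanSpace ℂ (Bits n)} (hφ : ‖φ‖ = 1)
    {r δ : ℝ} (hr : 0 < r) (hδ0 : 0 < δ) (hδ1 : δ < 1) {ρ : Op n} (hρ : ρ.PosSemidef)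
    (hρ1 : ρ.trace = 1) (hε : 0 < infidelity φ ρ) {M : ℝ} (hM : 0 ≤ M)
    (hvar : crmVariance R (pureState φ) (fidelityObservable φ) ρ ≤
      2 / R + 2 * M * infidelity φ ρ ^ 2) {B : ℕ}
    (hB : B = ⌈136 * Real.log (2 / δ) * (M / r ^ 2 + 1 / (R * r ^ 2 * infidelity φ ρ ^ 2))⌉₊) :
    hpfeVarianceCost R φ ρ r δ ≤ B ∧
      hpfeCost R φ ρ r δ (numGroups δ) ≤ ((max B (numGroups δ) : ℕ) : ℕ∞) ∧
      (1 ≤ 68 * δ * Real.log (2 / δ) → hpfeCost R φ ρ r δ 1 ≤ (B : ℕ∞)) := by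
  set ε := infidelity φ ρ
  set L := Real.log (2 / δ) with hL
  have hLpos : 2 / 3 < L := two_thirds_lt_log hδ0 hδ1
  have hR' : (0 : ℝ) < R := by exact_mod_cast hR
  have hle : 68 * crmVariance R (pureState φ) (fidelityObservable φ) ρ / (r * ε) ^ 2 * L ≤
      136 * L * (M / r ^ 2 + 1 / (R * r ^ 2 * ε ^ 2)) := by
    have e : 136 * L * (M / r ^ 2 + 1 / (R * r ^ 2 * ε ^ 2)) =
        68 * (2 / R + 2 * M * ε ^ 2) / (r * ε) ^ 2 * L := by
      field_simp
      ring
    rw [e]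
    gcongr
  have hceil : 136 * L * (M / r ^ 2 + 1 / (R * r ^ 2 * ε ^ 2)) ≤ B := hB ▸ Nat.le_ceil _
  -- The outcome term is strictly positive, so even the empirical mean is taken over at least one
  -- round.
  have hB1 : 1 ≤ B := by
    rw [hB]
    refine Nat.one_le_ceil_iff.2 ?_
    have : 0 < 1 / (R * r ^ 2 * ε ^ 2) := by positivity
    have : 0 ≤ M / r ^ 2 := by positivity
    have : 0 < 136 * L := by linarith
    positivity
  have hσ := star_pureState φ
  have hO : star (fidelityObservable φ) = fidelityObservable φ := star_traceless hσ
  have hO0 : (fidelityObservable φ).trace = 0 := trace_traceless (trace_pureState φ hφ)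
  refine ⟨?_, ?_, fun hδ => ?_⟩
  · rw [hpfeVarianceCost, hB]
    exact Nat.ceil_mono hle
  · refine circuitCost_le fun N hN => ?_
    refine succeeds_numGroups hR hσ hO hO0 hρ hρ1 (mul_pos hr hε) hδ0 hδ1
      ((le_max_right _ _).trans hN) ((hle.trans hceil).trans ?_)
    exact_mod_cast (le_max_left _ _).trans hN
  · refine circuitCost_le fun N hN => ?_
    refine succeeds_one hR hσ hO hO0 hρ hρ1 (mul_pos hr hε) hδ0 hδ1 (hB1.trans hN)
      ((hle.trans hceil).trans ?_) hδ
    exact_mod_cast hN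

end CRM

theorem theorem5 (n R : ℕ) (hR : 1 ≤ R) (φ : EuclideanSpace ℂ (CRM.Bits n)) (hφ : ‖φ‖ = 1)
    (r δ : ℝ) (hr : 0 < r) (hδ0 : 0 < δ) (hδ1 : δ < 1) :
    -- the reconstruction map is well defined
    IsUnit (CRM.measurementChannel n) ∧
    -- Pauli noise
    (∀ (p : CRM.PauliLabel n → ℝ), (∀ a, 0 ≤ p a) → ∑ a, p a = 1 →
      ∀ (ρ : CRM.Op n) (ε : ℝ), ρ = CRM.pauliChannel p (CRM.pureState φ) →
      ε = CRM.infidelity φ ρ → 0 < ε →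
      ∀ B : ℕ, B = ⌈136 * Real.log (2 / δ) * (2 / r ^ 2 + 1 / (R * r ^ 2 * ε ^ 2))⌉₊ →
        CRM.hpfeVarianceCost R φ ρ r δ ≤ B ∧
        CRM.hpfeCost R φ ρ r δ (CRM.numGroups δ) ≤ ((max B (CRM.numGroups δ) : ℕ) : ℕ∞) ∧
        (r ≤ 1 → CRM.hpfeCost R φ ρ r δ (CRM.numGroups δ) ≤ (B : ℕ∞)) ∧
        (1 ≤ 68 * δ * Real.log (2 / δ) → CRM.hpfeCost R φ ρ r δ 1 ≤ (B : ℕ∞))) ∧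
    -- depolarizing noise
    (∀ (q : ℝ), 0 ≤ q → q ≤ 1 →
      ∀ (ρ : CRM.Op n) (ε : ℝ), ρ = CRM.depolarizing q (CRM.pureState φ) →
      ε = CRM.infidelity φ ρ → 0 < ε →
      ∀ B : ℕ, B = ⌈136 * Real.log (2 / δ) *
          ((2 : ℝ) ^ (-CRM.sre2 (CRM.pureState φ)) / r ^ 2 + 1 / (R * r ^ 2 * ε ^ 2))⌉₊ →
        CRM.hpfeVarianceCost R φ ρ r δ ≤ B ∧
        CRM.hpfeCost R φ ρ r δ (CRM.numGroups δ) ≤ ((max B (CRM.numGroups δ) : ℕ) : ℕ∞) ∧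
        (1 ≤ 68 * δ * Real.log (2 / δ) → CRM.hpfeCost R φ ρ r δ 1 ≤ (B : ℕ∞))) := by
  refine ⟨CRM.isUnit_measurementChannel n, ?_, ?_⟩
  · rintro p hp0 hp ρ ε rfl rfl hε B hB
    have hρ := CRM.posSemidef_pauliChannel hp0 (CRM.posSemidef_pureState φ hφ)
    have hρ1 : (CRM.pauliChannel p (CRM.pureState φ)).trace = 1 := by
      rw [CRM.trace_pauliChannel hp, CRM.trace_pureState φ hφ]
    obtain ⟨h1, h2, h3⟩ := CRM.hpfeCost_bounds hR hφ hr hδ0 hδ1 hρ hρ1 hε (by norm_num : (0 : ℝ) ≤ 2)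
      (CRM.crmVariance_pauliChannel_le hφ hR hp0 hp) hB
    refine ⟨h1, h2, fun hr1 => ?_, h3⟩
    -- For r ≤ 1 the first term already gives 136L · 2/r² ≥ 2L, so the requirement of at least as
    -- many rounds as groups is automatic.
    have hK : CRM.numGroups δ ≤ B := by
      rw [hB]
      refine Nat.ceil_mono ?_
      have hL := CRM.two_thirds_lt_log hδ0 hδ1
      have h4 : 2 ≤ 2 / r ^ 2 := by
        rw [le_div_iff₀ (by positivity)]
        have : r ^ 2 ≤ 1 := pow_le_one₀ hr.le hr1
        linarith
      have h5 : 0 ≤ 1 / (R * r ^ 2 *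
          CRM.infidelity φ (CRM.pauliChannel p (CRM.pureState φ)) ^ 2) := by positivity
      nlinarith
    rwa [max_eq_left hK] at h2
  · rintro q hq0 hq1 ρ ε rfl rfl hε B hB
    exact CRM.hpfeCost_bounds hR hφ hr hδ0 hδ1 (CRM.posSemidef_depolarizing hφ hq0 hq1)
      (CRM.trace_depolarizing q (CRM.trace_pureState φ hφ)) hε (by positivity)
      (CRM.crmVariance_depolarizing_le hφ hR hq0 hq1) hB
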